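/- Notation. For $P\subseteq[0,1]^n$ let $P_I=\operatorname{conv}(P\cap\{0,1\}^n)$ and $\operatorname{cone}(P)=\{(\lambda,\lambda x)\in\mathbb R^{n+1}:\lambda\ge 0,\ x\in P\}$, the new coordinate being indexed by $0$. Let $\mathrm{LS}_+(P)$ be the set of all $x\in\mathbb R^n$ for which there is a symmetric positive semidefinite matrix $Y\in\mathbb R^{(n+1)\times(n+1)}$ with $Ye_0=\operatorname{diag}(Y)=\begin{pmatrix}1\\x\end{pmatrix}$ and $Ye_i,\ Y(e_0-e_i)\in\operatorname{cone}(P)$ for all $i\in\{1,\dots,n\}$. Put $\mathrm{LS}_+^0(P)=P$ and $\mathrm{LS}_+^{m}(P)=\mathrm{LS}_+(\mathrm{LS}_+^{m-1}(P))$ for $m\ge1$. The $\mathrm{LS}_+$-rank of $P$ is the smallest integer $m\ge 0$ with $\mathrm{LS}_+^m(P)=P_I$. The $\mathrm{LS}_+$-rank $r_+(G)$ of a finite simple graph $G$ is the $\mathrm{LS}_+$-rank of its fractional stable set polytope $\mathrm{FRAC}(G)=\{x\in[0,1]^{V(G)}: x_i+x_j\le 1 \text{ for all } \{i,j\}\in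 E(G)\}$. For an integer $\ell\ge 1$, the graph $G$ is called $\ell$-minimal if $r_+(G)=\ell$ and $|V(G)|=3\ell$. For an integer $k\ge3$ let $\mathcal A_k$ be the graph with $$V(\mathcal A_k)=\{1,2,3\}\cup\{i_0,i_1,i_2: 4\le i\le k\},$$ $$E(\mathcal A_k)=\{\{1,2\},\{2,3\},\{1,3\}\}\cup\{\{i_0,i_1\},\{i_0,i_2\},\{i_1,2\},\{i_1,3\},\{i_2,1\}:4\le i\le k\}\cup\{\{i_2,j_1\}:4\le i<j\le k\}.$$ **Proposition 5.2.** For every integer $k\ge 3$, the graph $\mathcal A_k$ is $(k-2)$-minimal; that is, $|V(\mathcal A_k)|=3(k-2)$ and $r_+(\mathcal A_k)=k-2$. -/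

import Mathlib

namespace LSPlus

/-- The integer hull `P_I = conv (P ∩ {0,1}^V)` of a set `P ⊆ ℝ^V`. -/
def integerHull {V : Type*} (P : Set (V → ℝ)) : Set (V → ℝ) :=
  convexHull ℝ (P ∩ {x | ∀ i, x i = 0 ∨ x i = 1})

/-- The homogenized cone `{(t, t x) : t ≥ 0, x ∈ P}` of `P ⊆ ℝ^V`. The new coordinate (index `0`
in the usual notation) is `none`, and the coordinate of `i : V` is `some i`. -/
def homCone {V : Type*} (P : Set (V → ℝ)) : Set (Option V → ℝ) :=
  {y | ∃ t : ℝ, 0 ≤ t ∧ ∃ x ∈ P, y none = t ∧ ∀ i, y (some i) = t * x i}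

/-- The lifted set of the operator: all symmetric positive semidefinite matrices `Y`, indexed by
`{0} ∪ V`, with `Y e₀ = diag Y` and with `Y e_i` and `Y (e₀ - e_i)` in the homogenized cone of `P`
for every `i`. Here `Y e_i` is written as the `i`-th column of `Y`. -/
def liftedSet {V : Type*} (P : Set (V → ℝ)) : Set (Matrix (Option V) (Option V) ℝ) :=
  {Y | Y.PosSemidef ∧ Y.col none = Y.diag ∧
    ∀ i : V, Y.col (some i) ∈ homCone P ∧ Y.col none - Y.col (some i) ∈ homCone P}

/-- The Lovász–Schrijver SDP operator `LS₊`: the projection of the lifted set, i.e. all `x` such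
that `Y e₀ = (1, x)` for some `Y` in the lifted set. -/
def lsPlus {V : Type*} (P : Set (V → ℝ)) : Set (V → ℝ) :=
  {x | ∃ Y ∈ liftedSet P, Y none none = 1 ∧ ∀ i, Y (some i) none = x i}

/-- `P` has `LS₊`-rank `r`: `r` is the smallest natural number with `LS₊^r(P) = P_I`. -/
def HasLSPlusRank {V : Type*} (P : Set (V → ℝ)) (r : ℕ) : Prop :=
  IsLeast {m : ℕ | lsPlus^[m] P = integerHull P} r

/-- The fractional stable set polytope of a graph. -/
def frac {V : Type*} (G : SimpleGraph V) : Set (V → ℝ) :=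
  {x | (∀ i, 0 ≤ x i ∧ x i ≤ 1) ∧ ∀ i j, G.Adj i j → x i + x j ≤ 1}

/-- A graph is `l`-minimal if the `LS₊`-rank of its fractional stable set polytope is `l` and it
has exactly `3 l` vertices. -/
def IsMinimal {V : Type*} [Fintype V] (G : SimpleGraph V) (l : ℕ) : Prop :=
  HasLSPlusRank (frac G) l ∧ Fintype.card V = 3 * l

/-- The vertices of `A_k`: three unstretched vertices `1, 2, 3` and the vertices `i_0, i_1, i_2` for
`4 ≤ i ≤ k`. -/
abbrev AVertex (k : ℕ) : Type := Fin 3 ⊕ (↥(Finset.Icc 4 k) × Fin 3)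

/-- The unstretched vertex `1`. -/
abbrev v₁ {k : ℕ} : AVertex k := Sum.inl 0

/-- The unstretched vertex `2`. -/
abbrev v₂ {k : ℕ} : AVertex k := Sum.inl 1

/-- The unstretched vertex `3`. -/
abbrev v₃ {k : ℕ} : AVertex k := Sum.inl 2

/-- The vertex `i_c`, for `4 ≤ i ≤ k` and `c ∈ {0, 1, 2}`. -/
abbrev vs {k : ℕ} (i : ↥(Finset.Icc 4 k)) (c : Fin 3) : AVertex k := Sum.inr (i, c)

/-- The edges of `A_k`, each listed with one orientation. -/
inductive AEdge (k : ℕ) : AVertex k → AVertex k → Prop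
  | e12 : AEdge k v₁ v₂
  | e23 : AEdge k v₂ v₃
  | e13 : AEdge k v₁ v₃
  | hub1 (i : ↥(Finset.Icc 4 k)) : AEdge k (vs i 0) (vs i 1)
  | hub2 (i : ↥(Finset.Icc 4 k)) : AEdge k (vs i 0) (vs i 2)
  | wing12 (i : ↥(Finset.Icc 4 k)) : AEdge k (vs i 1) v₂
  | wing13 (i : ↥(Finset.Icc 4 k)) : AEdge k (vs i 1) v₃
  | wing21 (i : ↥(Finset.Icc 4 k)) : AEdge k (vs i 2) v₁
  | cross (i j : ↥(Finset.Icc 4 k)) : i < j → AEdge k (vs i 2) (vs j 1)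

/-- The graph `A_k`. -/
def graphA (k : ℕ) : SimpleGraph (AVertex k) := SimpleGraph.fromRel (AEdge k)

end LSPlus

/-! Upper bound: every graph has $\mathrm{LS}_+$-rank at most a third of its order. In
`mem_integerHull_of_card_fracSupp` one counts fractional coordinates. A vertex with at most one
fractional neighbour can be set to 0 (`mem_integerHull_of_pendant`), so each fractional vertex $i$
may be assumed to have two fractional neighbours. The normalized column $Ye_i$ has value 1 at $i$,
hence 0 at its neighbours, and keeps the integral coordinates of $x$, so it has at least three
fractional coordinates fewer than $x$ and induction applies to it. Positive semidefiniteness then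
carries valid inequalities from these columns to $x$ (`mem_integerHull_of_mem_lsPlus`).

Lower bound: with $I$ the set of stretched vertices, $\sum_v x_v \le |I|+1$ is valid for the stable
set polytope (`sum_le_of_mem_integerHull`) but violated after $|I| = k-3$ rounds
(`exists_violation`). The induction is on $|I|$, over all finite linear orders at once. Start from
$\sum yy^{\mathsf T}$ over the homogenized maximum stable sets $y$, which lies on the boundary of
the inequality, and add $\varepsilon Z$ where $Z$ raises the sum. For small $\varepsilon$ the result
is feasible if two things hold. First, $Z$ is positive on the common kernel of the forms $y$; this
kernel is a line, because the maximum stable sets span a hyperplane. Second, each column of $Z$ is a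
tangent direction, a point of the span of the relevant stable sets plus a point of the cone.

The nontrivial tangent directions come from the induction hypothesis: a violating point for a graph
with one stretched vertex fewer makes all coordinate vectors tangent there (`unit_mem_tangent`), and
three substitutions transport them (`unit_mem_tangent_hub`, `unit_mem_tangent_last`,
`unit_mem_tangent_first`). `exists_violation_succ` assembles these. -/

namespace LSPlus

/-! ### Homogenized cones and elementary properties of $\mathrm{LS}_+$. -/

section Cone

variable {V : Type*}

/-- The homogenization `(1, x)` of a point `x`. -/
def hom (x : V → ℝ) : Option V → ℝ := fun o => o.elim 1 x

@[simp] lemma hom_none (x : V → ℝ) : hom x none = 1 := rfl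

@[simp] lemma hom_some (x : V → ℝ) (v : V) : hom x (some v) = x v := rfl

lemma mem_homCone_iff {P : Set (V → ℝ)} {y : Option V → ℝ} :
    y ∈ homCone P ↔ ∃ t : ℝ, 0 ≤ t ∧ ∃ x ∈ P, y = t • hom x := by
  constructor
  · rintro ⟨t, ht, x, hx, h0, h1⟩
    refine ⟨t, ht, x, hx, ?_⟩
    ext o
    cases o <;> simp [h0, h1]
  · rintro ⟨t, ht, x, hx, rfl⟩
    exact ⟨t, ht, x, hx, by simp, by simp⟩

lemma hom_mem_homCone {P : Set (V → ℝ)} {x : V → ℝ} : hom x ∈ homCone P ↔ x ∈ P := by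
  rw [mem_homCone_iff]
  constructor
  · rintro ⟨t, -, z, hz, h⟩
    have ht : t = 1 := by simpa using (congrFun h none).symm
    have : x = z := by
      ext v
      simpa [ht] using congrFun h (some v)
    rwa [this]
  · exact fun h => ⟨1, zero_le_one, x, h, (one_smul _ _).symm⟩

lemma smul_mem_homCone {P : Set (V → ℝ)} {y : Option V → ℝ} (hy : y ∈ homCone P) {c : ℝ}
    (hc : 0 ≤ c) : c • y ∈ homCone P := by
  rw [mem_homCone_iff] at *
  obtain ⟨t, ht, x, hx, rfl⟩ := hy
  exact ⟨c * t, mul_nonneg hc ht, x, hx, smul_smul _ _ _⟩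

lemma zero_mem_homCone {P : Set (V → ℝ)} (hP : P.Nonempty) : 0 ∈ homCone P := by
  obtain ⟨x, hx⟩ := hP
  exact mem_homCone_iff.2 ⟨0, le_rfl, x, hx, (zero_smul _ _).symm⟩

lemma nonempty_of_mem_homCone {P : Set (V → ℝ)} {y : Option V → ℝ} (hy : y ∈ homCone P) :
    P.Nonempty := by
  obtain ⟨_, _, x, hx, _⟩ := hy
  exact ⟨x, hx⟩

lemma add_mem_homCone {P : Set (V → ℝ)} (hP : Convex ℝ P) {y z : Option V → ℝ}
    (hy : y ∈ homCone P) (hz : z ∈ homCone P) : y + z ∈ homCone P := by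
  rw [mem_homCone_iff] at *
  obtain ⟨t, ht, x, hx, rfl⟩ := hy
  obtain ⟨s, hs, w, hw, rfl⟩ := hz
  rcases (add_nonneg ht hs).eq_or_lt with h | h
  · obtain rfl : t = 0 := by linarith
    obtain rfl : s = 0 := by linarith
    exact ⟨0, le_rfl, x, hx, by simp⟩
  · refine ⟨t + s, h.le, (t / (t + s)) • x + (s / (t + s)) • w,
      hP hx hw (by positivity) (by positivity) (by field_simp), ?_⟩
    ext o
    cases o with
    | none => simp
    | some v => simp; field_simp

lemma sum_mem_homCone {P : Set (V → ℝ)} (hP : Convex ℝ P) (hne : P.Nonempty) {ι : Type*}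
    (s : Finset ι) (f : ι → Option V → ℝ) (h : ∀ i ∈ s, f i ∈ homCone P) :
    ∑ i ∈ s, f i ∈ homCone P := by
  classical
  induction s using Finset.induction_on with
  | empty => simpa using zero_mem_homCone hne
  | insert a s ha ih =>
    rw [Finset.sum_insert ha]
    exact add_mem_homCone hP (h a (by simp)) (ih fun i hi => h i (by simp [hi]))

/-- A nonzero point of the homogenized cone is a positive multiple of a homogenized point. -/
lemma exists_eq_smul_hom {P : Set (V → ℝ)} {y : Option V → ℝ} (hy : y ∈ homCone P) :
    0 ≤ y none ∧ ∃ x ∈ P, y = y none • hom x := by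
  obtain ⟨t, ht, x, hx, rfl⟩ := mem_homCone_iff.1 hy
  exact ⟨by simpa using ht, x, hx, by simp⟩

lemma liftedSet_smul {P : Set (V → ℝ)} {Y : Matrix (Option V) (Option V) ℝ}
    (hY : Y ∈ liftedSet P) {c : ℝ} (hc : 0 ≤ c) : c • Y ∈ liftedSet P := by
  refine ⟨hY.1.smul hc, ?_, fun i => ⟨smul_mem_homCone (hY.2.2 i).1 hc, ?_⟩⟩
  · ext a
    have := congrFun hY.2.1 a
    simp only [Matrix.col_apply, Matrix.diag_apply] at this
    simp [Matrix.col_apply, this]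
  · have := smul_mem_homCone (hY.2.2 i).2 hc
    rwa [smul_sub] at this

lemma liftedSet_add {P : Set (V → ℝ)} (hP : Convex ℝ P) {Y Z : Matrix (Option V) (Option V) ℝ}
    (hY : Y ∈ liftedSet P) (hZ : Z ∈ liftedSet P) : Y + Z ∈ liftedSet P := by
  refine ⟨hY.1.add hZ.1, ?_, fun i =>
    ⟨add_mem_homCone hP (hY.2.2 i).1 (hZ.2.2 i).1, ?_⟩⟩
  · have h1 := hY.2.1
    have h2 := hZ.2.1
    calc (Y + Z).col none = Y.col none + Z.col none := rfl
      _ = Y.diag + Z.diag := by rw [h1, h2]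
      _ = (Y + Z).diag := rfl
  · have := add_mem_homCone hP (hY.2.2 i).2 (hZ.2.2 i).2
    rwa [sub_add_sub_comm] at this

lemma convex_lsPlus {P : Set (V → ℝ)} (hP : Convex ℝ P) : Convex ℝ (lsPlus P) := by
  rintro x ⟨Y, hY, hY0, hYx⟩ z ⟨Z, hZ, hZ0, hZz⟩ a b ha hb hab
  refine ⟨a • Y + b • Z, liftedSet_add hP (liftedSet_smul hY ha) (liftedSet_smul hZ hb), ?_, ?_⟩
  · simp [hY0, hZ0, hab]
  · intro i
    simp [hYx, hZz]

lemma convex_iterate_lsPlus {P : Set (V → ℝ)} (hP : Convex ℝ P) (m : ℕ) :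
    Convex ℝ (lsPlus^[m] P) := by
  induction m with
  | zero => exact hP
  | succ m ih => rw [Function.iterate_succ_apply']; exact convex_lsPlus ih

lemma col_none_mem_homCone {P : Set (V → ℝ)} [Nonempty V] (hP : Convex ℝ P)
    {Y : Matrix (Option V) (Option V) ℝ} (hY : Y ∈ liftedSet P) : Y.col none ∈ homCone P := by
  obtain ⟨v⟩ := ‹Nonempty V›
  simpa using add_mem_homCone hP (hY.2.2 v).2 (hY.2.2 v).1

lemma col_none_eq_hom {Y : Matrix (Option V) (Option V) ℝ} {x : V → ℝ}
    (h0 : Y none none = 1) (hx : ∀ i, Y (some i) none = x i) : Y.col none = hom x := by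
  ext o
  cases o with
  | none => exact h0
  | some v => exact hx v

lemma lsPlus_subset [Nonempty V] {P : Set (V → ℝ)} (hP : Convex ℝ P) : lsPlus P ⊆ P := by
  rintro x ⟨Y, hY, h0, hx⟩
  have := col_none_mem_homCone hP hY
  rwa [col_none_eq_hom h0 hx, hom_mem_homCone] at this

lemma iterate_lsPlus_anti [Nonempty V] {P : Set (V → ℝ)} (hP : Convex ℝ P) {m n : ℕ}
    (h : m ≤ n) : lsPlus^[n] P ⊆ lsPlus^[m] P := by
  induction n, h using Nat.le_induction with
  | base => exact subset_rfl
  | succ n _ ih =>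
    rw [Function.iterate_succ_apply']
    exact (lsPlus_subset (convex_iterate_lsPlus hP n)).trans ih

/-- Scaling a lifted matrix to corner entry `1`. -/
lemma mem_lsPlus_of_liftedSet {P : Set (V → ℝ)} {Y : Matrix (Option V) (Option V) ℝ}
    (hY : Y ∈ liftedSet P) (h0 : 0 < Y none none) :
    (fun v => Y (some v) none / Y none none) ∈ lsPlus P :=
  ⟨(Y none none)⁻¹ • Y, liftedSet_smul hY (inv_nonneg.2 h0.le), by simp [h0.ne'],
    fun i => by simp [div_eq_inv_mul]⟩

end Cone

/-! ### Integral points survive every round. -/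

section Integral

variable {V : Type*} [Fintype V]

/-- The rank-one matrix of $(1,x)$ works: its $i$-th column is $x_i(1,x)$, and $x_i^2 = x_i$ gives
the diagonal condition. -/
lemma mem_lsPlus_of_integral {P : Set (V → ℝ)} {x : V → ℝ} (hx : x ∈ P)
    (h01 : ∀ i, x i = 0 ∨ x i = 1) : x ∈ lsPlus P := by
  have key : ∀ i : V, (Matrix.vecMulVec (hom x) (hom x)).col (some i) = x i • hom x := by
    intro i
    ext o
    simp [Matrix.col_apply, Matrix.vecMulVec_apply, mul_comm]
  have key0 : (Matrix.vecMulVec (hom x) (hom x)).col none = hom x := by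
    ext o
    simp [Matrix.col_apply, Matrix.vecMulVec_apply]
  refine ⟨Matrix.vecMulVec (hom x) (hom x), ⟨?_, ?_, fun i => ⟨?_, ?_⟩⟩, ?_, ?_⟩
  · simpa using Matrix.posSemidef_vecMulVec_self_star (hom x)
  · rw [key0]
    ext o
    cases o with
    | none => simp [Matrix.vecMulVec_apply]
    | some v => rcases h01 v with h | h <;> simp [Matrix.vecMulVec_apply, h]
  · rw [key]
    exact smul_mem_homCone (hom_mem_homCone.2 hx) (by rcases h01 i with h | h <;> simp [h])
  · rw [key, key0]
    have : hom x - x i • hom x = (1 - x i) • hom x := by rw [sub_smul, one_smul]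
    rw [this]
    exact smul_mem_homCone (hom_mem_homCone.2 hx) (by rcases h01 i with h | h <;> simp [h])
  · simp [Matrix.vecMulVec_apply]
  · simp [Matrix.vecMulVec_apply]

lemma mem_iterate_lsPlus_of_integral {P : Set (V → ℝ)} {x : V → ℝ} (hx : x ∈ P)
    (h01 : ∀ i, x i = 0 ∨ x i = 1) (m : ℕ) : x ∈ lsPlus^[m] P := by
  induction m with
  | zero => exact hx
  | succ m ih => rw [Function.iterate_succ_apply']; exact mem_lsPlus_of_integral ih h01

lemma integerHull_subset_iterate_lsPlus {P : Set (V → ℝ)} (hP : Convex ℝ P) (m : ℕ) :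
    integerHull P ⊆ lsPlus^[m] P :=
  convexHull_min (fun _ hx => mem_iterate_lsPlus_of_integral hx.1 hx.2 m)
    (convex_iterate_lsPlus hP m)

end Integral

/-! ### Literal substitutions, which commute with $\mathrm{LS}_+$. -/

/-- A coordinate of an affine substitution `x ↦ x'`: one of `0`, `1`, `x_v`, `1 - x_v`. -/
inductive Lit (V : Type*)
  | zero
  | one
  | pos (v : V)
  | neg (v : V)

section Subst

variable {V W : Type*}

/-- Homogeneous evaluation of a literal. -/
def Lit.eval (y : Option V → ℝ) : Lit V → ℝ
  | .zero => 0
  | .one => y none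
  | .pos v => y (some v)
  | .neg v => y none - y (some v)

/-- The linear map given by substituting literals. -/
def subst (ρ : W → Lit V) : (Option V → ℝ) →ₗ[ℝ] (Option W → ℝ) where
  toFun y o := o.elim (y none) fun w => (ρ w).eval y
  map_add' y z := by
    ext o
    cases o with
    | none => rfl
    | some w => simp only [Option.elim, Pi.add_apply]; cases ρ w <;> simp [Lit.eval]; ring
  map_smul' c y := by
    ext o
    cases o with
    | none => rfl
    | some w =>
      simp only [Option.elim, Pi.smul_apply]; cases ρ w <;> simp [Lit.eval, mul_sub]

@[simp] lemma subst_none (ρ : W → Lit V) (y : Option V → ℝ) : subst ρ y none = y none := rfl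

@[simp] lemma subst_some (ρ : W → Lit V) (y : Option V → ℝ) (w : W) :
    subst ρ y (some w) = (ρ w).eval y := rfl

/-- The affine map given by substituting literals. -/
def substPt (ρ : W → Lit V) (x : V → ℝ) : W → ℝ := fun w => (ρ w).eval (hom x)

lemma subst_hom (ρ : W → Lit V) (x : V → ℝ) : subst ρ (hom x) = hom (substPt ρ x) := by
  ext o
  cases o <;> rfl

lemma subst_mem_homCone {P : Set (V → ℝ)} {Q : Set (W → ℝ)} {ρ : W → Lit V}
    (h : ∀ x ∈ P, substPt ρ x ∈ Q) {y : Option V → ℝ} (hy : y ∈ homCone P) :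
    subst ρ y ∈ homCone Q := by
  obtain ⟨t, ht, x, hx, rfl⟩ := mem_homCone_iff.1 hy
  rw [map_smul, subst_hom]
  exact smul_mem_homCone (hom_mem_homCone.2 (h x hx)) ht

variable [Fintype V] [Fintype W]

/-- The matrix is the congruence $RYR^{\mathsf T}$ with $R$ the matrix of `subst ρ`. -/
lemma posSemidef_subst (ρ : W → Lit V) {Y : Matrix (Option V) (Option V) ℝ}
    (hY : Y.PosSemidef) :
    (Matrix.of fun a b => subst ρ (fun c => subst ρ (Y.col c) a) b).PosSemidef := by
  classical
  have hR := hY.mul_mul_conjTranspose_same (LinearMap.toMatrix' (subst ρ))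
  convert hR using 1
  have h1 : ∀ a c, (LinearMap.toMatrix' (subst ρ) * Y) a c = subst ρ (Y.col c) a := by
    intro a c
    rw [← LinearMap.toMatrix'_mulVec (subst ρ)]
    rfl
  ext a b
  rw [Matrix.mul_apply]
  simp only [h1, Matrix.of_apply]
  rw [← LinearMap.toMatrix'_mulVec (subst ρ) fun c => subst ρ (Y.col c) a]
  simp [Matrix.mulVec, dotProduct, Matrix.conjTranspose_apply, mul_comm]

/-- With $R$ the matrix of `subst ρ`, the witness is $RYR^{\mathsf T}$. Its column at $w$ is the
image under $R$ of $0$, $Ye_0$, $Ye_v$ or $Y(e_0-e_v)$, according to the literal, and the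
complementary column is the image of the complementary vector in this list. This closure under
complements is why exactly these four literals are allowed. -/
lemma subst_mem_lsPlus [Nonempty V] {P : Set (V → ℝ)} {Q : Set (W → ℝ)} (hP : Convex ℝ P)
    {ρ : W → Lit V} (h : ∀ x ∈ P, substPt ρ x ∈ Q) {x : V → ℝ} (hx : x ∈ lsPlus P) :
    substPt ρ x ∈ lsPlus Q := by
  obtain ⟨Y, hY, h0, hYx⟩ := hx
  have hc0 := col_none_mem_homCone hP hY
  have hdiag : ∀ a, Y a none = Y a a := fun a => congrFun hY.2.1 a
  have hsymm : ∀ a b, Y a b = Y b a := fun a b => by simpa using hY.1.1.apply b a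
  have hz : (0 : Option W → ℝ) ∈ homCone Q := by
    obtain ⟨x, hx⟩ := nonempty_of_mem_homCone hc0
    exact zero_mem_homCone ⟨_, h x hx⟩
  set Y' : Matrix (Option W) (Option W) ℝ :=
    Matrix.of fun a b => subst ρ (fun c => subst ρ (Y.col c) a) b with hY'
  have hcol0 : Y'.col none = subst ρ (Y.col none) := rfl
  refine ⟨Y', ⟨posSemidef_subst ρ hY.1, ?_, fun w => ?_⟩, ?_, fun w => ?_⟩
  · ext a
    cases a with
    | none => rfl
    | some w =>
      simp only [hY', Matrix.col_apply, Matrix.diag_apply, Matrix.of_apply, subst_none,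
        subst_some]
      cases ρ w with
      | zero => simp [Lit.eval]
      | one => simp [Lit.eval]
      | pos v => simp [Lit.eval, Matrix.col_apply, hdiag]
      | neg v =>
        simp only [Lit.eval, Matrix.col_apply]
        rw [hsymm none (some v), hdiag (some v)]
        ring
  · rw [hcol0]
    have hcol : Y'.col (some w) =
        fun a => (ρ w).eval (fun c => subst ρ (Y.col c) a) := rfl
    rw [hcol]
    cases hw : ρ w with
    | zero =>
      refine ⟨hz, ?_⟩
      convert subst_mem_homCone h hc0 using 1
      ext a
      simp [Lit.eval]
    | one =>
      refine ⟨subst_mem_homCone h hc0, ?_⟩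
      convert hz using 1
      ext a
      simp [Lit.eval]
    | pos v =>
      refine ⟨subst_mem_homCone h (hY.2.2 v).1, ?_⟩
      have := subst_mem_homCone h (hY.2.2 v).2
      rwa [map_sub] at this
    | neg v =>
      have := subst_mem_homCone h (hY.2.2 v).2
      rw [map_sub] at this
      refine ⟨this, ?_⟩
      convert subst_mem_homCone h (hY.2.2 v).1 using 1
      ext a
      simp [Lit.eval]
  · exact h0
  · have : Y'.col none (some w) = substPt ρ x w := by
      rw [hcol0, col_none_eq_hom h0 hYx]
      rfl
    exact this

lemma subst_mem_iterate_lsPlus [Nonempty V] {P : Set (V → ℝ)} {Q : Set (W → ℝ)}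
    (hP : Convex ℝ P) {ρ : W → Lit V} (h : ∀ x ∈ P, substPt ρ x ∈ Q) (m : ℕ) :
    ∀ x ∈ lsPlus^[m] P, substPt ρ x ∈ lsPlus^[m] Q := by
  induction m with
  | zero => exact h
  | succ m ih =>
    intro x hx
    rw [Function.iterate_succ_apply'] at hx ⊢
    exact subst_mem_lsPlus (convex_iterate_lsPlus hP m) ih hx

end Subst

/-! ### The fractional stable set polytope. -/

section Frac

variable {V : Type*} (G : SimpleGraph V)

lemma convex_frac : Convex ℝ (frac G) := by
  rintro x ⟨hx, hx'⟩ y ⟨hy, hy'⟩ a b ha hb hab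
  refine ⟨fun i => ⟨?_, ?_⟩, fun i j hij => ?_⟩
  · have := mul_nonneg ha (hx i).1
    have := mul_nonneg hb (hy i).1
    simpa using by linarith
  · have := mul_le_mul_of_nonneg_left (hx i).2 ha
    have := mul_le_mul_of_nonneg_left (hy i).2 hb
    simp only [Pi.add_apply, Pi.smul_apply, smul_eq_mul]
    linarith
  · have := mul_le_mul_of_nonneg_left (hx' i j hij) ha
    have := mul_le_mul_of_nonneg_left (hy' i j hij) hb
    simp only [Pi.add_apply, Pi.smul_apply, smul_eq_mul]
    linarith

lemma zero_mem_frac : 0 ∈ frac G := ⟨fun _ => by simp, fun _ _ _ => by simp⟩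

lemma iterate_lsPlus_frac_subset [Nonempty V] (m : ℕ) : lsPlus^[m] (frac G) ⊆ frac G :=
  iterate_lsPlus_anti (convex_frac G) (Nat.zero_le m)

lemma mem_integerHull_frac {x : V → ℝ} (hx : x ∈ frac G) (h : ∀ i, x i = 0 ∨ x i = 1) :
    x ∈ integerHull (frac G) := subset_convexHull ℝ _ ⟨hx, h⟩

end Frac

end LSPlus

namespace LSPlus

/-! ### Upper bound: the rank is at most a third of the number of vertices. -/

section Upper

variable {V : Type*}

lemma hom_combo (x y : V → ℝ) {a b : ℝ} (hab : a + b = 1) :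
    hom (a • x + b • y) = a • hom x + b • hom y := by
  ext o
  cases o <;> simp [hab]

lemma substPt_combo {W : Type*} (ρ : W → Lit V) (x y : V → ℝ) {a b : ℝ} (hab : a + b = 1) :
    substPt ρ (a • x + b • y) = a • substPt ρ x + b • substPt ρ y := by
  ext w
  have h := congrFun (congrArg (subst ρ) (hom_combo x y hab)) (some w)
  rwa [map_add, map_smul, map_smul] at h

/-- A substitution preserving the `0/1` points preserves the integer hull. -/
lemma substPt_mem_integerHull {W : Type*} {P : Set (V → ℝ)} {Q : Set (W → ℝ)} {ρ : W → Lit V}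
    (h : ∀ x ∈ P, (∀ i, x i = 0 ∨ x i = 1) →
      substPt ρ x ∈ Q ∧ ∀ w, substPt ρ x w = 0 ∨ substPt ρ x w = 1)
    {x : V → ℝ} (hx : x ∈ integerHull P) : substPt ρ x ∈ integerHull Q := by
  have hconv : Convex ℝ {x | substPt ρ x ∈ integerHull Q} := by
    intro y hy z hz a b ha hb hab
    simp only [Set.mem_ofPred_eq] at *
    rw [substPt_combo ρ y z hab]
    exact convex_convexHull ℝ _ hy hz ha hb hab
  refine convexHull_min ?_ hconv hx
  intro y hy
  exact subset_convexHull ℝ _ (h y hy.1 hy.2)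

/-- A fractional vertex with at most one fractional neighbour does not affect membership in the
stable set polytope. -/
lemma mem_integerHull_of_pendant [DecidableEq V] (G : SimpleGraph V) {x : V → ℝ} (hx : x ∈ frac G)
    {i : V} (hi0 : 0 < x i)
    (hdeg : ∀ j j', G.Adj i j → G.Adj i j' → 0 < x j → 0 < x j' → j = j')
    (h : Function.update x i 0 ∈ integerHull (frac G)) : x ∈ integerHull (frac G) := by
  -- The literal `l` is the largest value that $i$ can take next to the support of $x$: $1-x_j$ if
  -- $j$ is the only positive neighbour, and 1 if there is none.
  obtain ⟨l, hl01, hladj, hle⟩ : ∃ l : Lit V,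
      (∀ z : V → ℝ, (∀ v, z v = 0 ∨ z v = 1) → l.eval (hom z) = 0 ∨ l.eval (hom z) = 1) ∧
      (∀ z : V → ℝ, (∀ v, z v = 0 ∨ z v = 1) → ∀ v, G.Adj i v → x v ≠ 0 →
        l.eval (hom z) + z v ≤ 1) ∧
      x i ≤ l.eval (hom (Function.update x i 0)) := by
    by_cases hj : ∃ j, G.Adj i j ∧ 0 < x j
    · obtain ⟨j, hij, hj0⟩ := hj
      refine ⟨.neg j, fun z hz => ?_, fun z hz v hv hv0 => ?_, ?_⟩
      · rcases hz j with h | h <;> simp [Lit.eval, h]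
      · have hvp : 0 < x v := lt_of_le_of_ne (hx.1 v).1 (Ne.symm hv0)
        obtain rfl := hdeg j v hij hv hj0 hvp
        simp [Lit.eval]
      · have := hx.2 i j hij
        simp only [Lit.eval, hom_none, hom_some, Function.update_of_ne hij.ne']
        linarith
    · push Not at hj
      refine ⟨.one, fun z hz => by simp [Lit.eval], fun z hz v hv hv0 => ?_, ?_⟩
      · exact absurd (le_antisymm (hj v hv) (hx.1 v).1) hv0
      · simpa [Lit.eval] using (hx.1 i).2
  classical
  -- Zeros of $x$ are forced to stay zero, since a stable set `z` could otherwise contain a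
  -- neighbour of $i$ other than $j$.
  set ρ : V → Lit V := fun v => if v = i then l else if x v = 0 then .zero else .pos v with hρ
  have hi : ∀ z, substPt ρ z i = l.eval (hom z) := fun z => by simp [substPt, hρ]
  have hne : ∀ z v, v ≠ i → substPt ρ z v = if x v = 0 then 0 else z v := by
    intro z v hv
    by_cases h0 : x v = 0 <;> simp [substPt, hρ, hv, h0, Lit.eval]
  have key : substPt ρ (Function.update x i 0) ∈ integerHull (frac G) := by
    refine substPt_mem_integerHull (fun z hz hz01 => ?_) h
    have h01 : ∀ w, substPt ρ z w = 0 ∨ substPt ρ z w = 1 := by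
      intro w
      by_cases hw : w = i
      · subst hw
        rw [hi]
        exact hl01 z hz01
      · rw [hne z w hw]
        split_ifs
        · exact Or.inl rfl
        · exact hz01 w
    refine ⟨⟨fun w => ?_, ?_⟩, h01⟩
    · rcases h01 w with h | h <;> simp [h]
    · have hiv : ∀ v, G.Adj i v → substPt ρ z i + substPt ρ z v ≤ 1 := by
        intro v hv
        rw [hi, hne z v hv.ne']
        split_ifs with h0
        · rcases hl01 z hz01 with h | h <;> simp [h]
        · exact hladj z hz01 v hv h0
      intro v w hvw
      by_cases hv : v = i
      · subst hv
        exact hiv w hvw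
      · by_cases hw : w = i
        · subst hw
          rw [add_comm]
          exact hiv v hvw.symm
        · rw [hne z v hv, hne z w hw]
          have := hz.2 v w hvw
          have := (hz.1 v).1
          have := (hz.1 w).1
          split_ifs <;> linarith
  set c := l.eval (hom (Function.update x i 0)) with hc
  have hcpos : 0 < c := hi0.trans_le hle
  -- Only coordinate $i$ differs between the two points, with values 0 and `c`; since $0 < x_i \le
  -- c$, the point $x$ lies on the segment joining them.
  have hcombo : x = (1 - x i / c) • Function.update x i 0 +
      (x i / c) • substPt ρ (Function.update x i 0) := by
    ext v
    by_cases hv : v = i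
    · subst hv
      simp [hi, ← hc, hcpos.ne']
    · simp only [Pi.add_apply, Pi.smul_apply, smul_eq_mul, hne _ v hv, Function.update_of_ne hv]
      split_ifs with h0
      · simp [h0]
      · ring
  rw [hcombo]
  refine convex_convexHull ℝ _ h key ?_ (by positivity) (by ring)
  rw [sub_nonneg, div_le_one hcpos]
  exact hle

variable [Fintype V]

lemma finite_integral_points : {x : V → ℝ | ∀ i, x i = 0 ∨ x i = 1}.Finite := by
  have : {x : V → ℝ | ∀ i, x i = 0 ∨ x i = 1} = Set.pi Set.univ fun _ => ({0, 1} : Set ℝ) := by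
    ext x
    simp
  rw [this]
  exact Set.Finite.pi fun _ => by simp

/-- The positive semidefinite step: if all columns belonging to fractional vertices satisfy the
inequalities of the stable set polytope, so does the point itself. -/
lemma mem_integerHull_of_mem_lsPlus (G : SimpleGraph V) {P : Set (V → ℝ)} {x : V → ℝ}
    (hxf : x ∈ frac G) (hx : x ∈ lsPlus P)
    (hcol : ∀ i, 0 < x i → x i < 1 → ∀ z ∈ P, z i = 1 → (∀ v, x v = 0 → z v = 0) →
      (∀ v, x v = 1 → z v = 1) → z ∈ integerHull (frac G)) :
    x ∈ integerHull (frac G) := by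
  classical
  by_contra hnot
  obtain ⟨f, u, hfu, hux⟩ := geometric_hahn_banach_closed_point (convex_convexHull ℝ _)
    ((finite_integral_points.subset Set.inter_subset_right).isClosed_convexHull (𝕜 := ℝ)) hnot
  set a : V → ℝ := fun v => f (Pi.single v 1) with ha
  have hf : ∀ y, f y = ∑ v, a v * y v := by
    intro y
    conv_lhs => rw [← Finset.univ_sum_single y]
    rw [map_sum]
    refine Finset.sum_congr rfl fun v _ => ?_
    have : (Pi.single v (y v) : V → ℝ) = y v • Pi.single v 1 := by
      rw [← Pi.single_smul]; simp
    rw [this, map_smul, smul_eq_mul, mul_comm]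
  set F : V → Prop := fun v => 0 < x v ∧ x v < 1 with hF
  -- Only columns of fractional vertices are controlled, so the contribution of the integral
  -- coordinates is frozen into the constant `κ`. Negative coefficients may be dropped because
  -- subsets of stable sets are stable.
  set a' : V → ℝ := fun v => if F v then max (a v) 0 else 0 with ha'
  have ha'0 : ∀ v, 0 ≤ a' v := by
    intro v
    simp only [ha']
    split_ifs
    · exact le_max_right _ _
    · exact le_rfl
  set κ : ℝ := ∑ v, if F v then 0 else a v * x v with hκ
  set β : ℝ := u - κ with hβ
  have hstab : ∀ z ∈ frac G, (∀ i, z i = 0 ∨ z i = 1) → ∑ v, a' v * z v < β := by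
    intro z hz hz01
    -- The part of `z` with positive coefficients is glued to the integral part of $x$. This is
    -- again a stable set, as a neighbour of a vertex with $x$-value 1 has value 0 and so is not
    -- fractional.
    set s : V → ℝ := fun v => if F v then (if 0 < a v then z v else 0) else x v with hs
    have hnF : ∀ v, ¬ F v → x v = 0 ∨ x v = 1 := by
      intro v hv
      by_contra hcon
      push Not at hcon
      exact hv ⟨lt_of_le_of_ne (hxf.1 v).1 hcon.1.symm, lt_of_le_of_ne (hxf.1 v).2 hcon.2⟩
    have hs01 : ∀ v, s v = 0 ∨ s v = 1 := by
      intro v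
      simp only [hs]
      split_ifs with h1 h2
      · exact hz01 v
      · exact Or.inl rfl
      · exact hnF v h1
    have hsz : ∀ v, F v → s v ≤ z v := by
      intro v hv
      simp only [hs, if_pos hv]
      split_ifs
      · exact le_rfl
      · exact (hz.1 v).1
    have hsx : ∀ v, ¬ F v → s v = x v := fun v hv => by simp [hs, hv]
    have hmix : ∀ v w, G.Adj v w → F v → ¬ F w → s v + s w ≤ 1 := by
      intro v w hvw hv hw
      have h1 := hxf.2 v w hvw
      rcases hnF w hw with h | h
      · rw [hsx w hw, h]
        have := hsz v hv
        have := (hz.1 v).2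
        linarith
      · have := hv.1
        linarith
    have hsfrac : s ∈ frac G := by
      refine ⟨fun v => by rcases hs01 v with h | h <;> simp [h], fun v w hvw => ?_⟩
      by_cases hv : F v <;> by_cases hw : F w
      · have := hsz v hv
        have := hsz w hw
        have := hz.2 v w hvw
        linarith
      · exact hmix v w hvw hv hw
      · rw [add_comm]
        exact hmix w v hvw.symm hw hv
      · rw [hsx v hv, hsx w hw]
        exact hxf.2 v w hvw
    have h1 := hfu s (mem_integerHull_frac G hsfrac hs01)
    rw [hf] at h1
    have h2 : ∑ v, a v * s v = ∑ v, a' v * z v + κ := by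
      rw [hκ, ← Finset.sum_add_distrib]
      refine Finset.sum_congr rfl fun v _ => ?_
      simp only [hs, ha']
      by_cases hv : F v
      · by_cases hav : 0 < a v
        · simp [hv, hav, hav.le]
        · simp [hv, hav, max_eq_right (not_lt.1 hav)]
      · simp [hv]
    rw [hβ]
    linarith
  have hβ0 : 0 < β := by
    simpa using hstab 0 (zero_mem_frac G) fun _ => Or.inl rfl
  have hhull : ∀ z ∈ integerHull (frac G), ∑ v, a' v * z v ≤ β := by
    intro z hz
    have hconv : Convex ℝ {z : V → ℝ | ∑ v, a' v * z v ≤ β} := by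
      refine convex_halfSpace_le (f := fun z : V → ℝ => ∑ v, a' v * z v) ⟨?_, ?_⟩ β
      · intro y z
        simp [mul_add, Finset.sum_add_distrib]
      · intro c z
        simp only [Pi.smul_apply, smul_eq_mul, Finset.mul_sum]
        exact Finset.sum_congr rfl fun v _ => by ring
    exact convexHull_min (fun y hy => (hstab y hy.1 hy.2).le) hconv hz
  have hviol : β < ∑ v, a' v * x v := by
    rw [hf] at hux
    have : ∑ v, a v * x v ≤ ∑ v, a' v * x v + κ := by
      rw [hκ, ← Finset.sum_add_distrib]
      refine Finset.sum_le_sum fun v _ => ?_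
      simp only [ha']
      by_cases hv : F v
      · simp only [hv, if_true, add_zero]
        exact mul_le_mul_of_nonneg_right (le_max_left _ _) (hxf.1 v).1
      · simp [hv]
    rw [hβ]
    linarith
  obtain ⟨Y, hY, h0, hYx⟩ := hx
  have hsymm : ∀ b c, Y b c = Y c b := fun b c => by simpa using hY.1.1.apply c b
  have hdiag : ∀ b, Y b none = Y b b := fun b => congrFun hY.2.1 b
  -- The column at $i$ is $x_i(1,z)$ with $z$ in the stable set polytope; the bound `β` at $z$ says
  -- that entry $i$ of $Y(\beta,-a')$ is nonnegative.
  have hD : ∀ i, F i → 0 ≤ β * Y (some i) none - ∑ v, a' v * Y (some i) (some v) := by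
    intro i hi
    obtain ⟨hcol1, hcol2⟩ := hY.2.2 i
    obtain ⟨-, z, hzP, hz⟩ := exists_eq_smul_hom hcol1
    have hc0 : Y.col (some i) none = x i := by
      rw [Matrix.col_apply, hsymm, hYx]
    rw [hc0] at hz
    have hzv : ∀ v, Y (some v) (some i) = x i * z v := fun v => by
      simpa using congrFun hz (some v)
    have hzi : z i = 1 := by
      have h1 := hzv i
      rw [← hdiag, hYx] at h1
      have h2 : x i * 1 = x i * z i := by rwa [mul_one]
      exact (mul_left_cancel₀ hi.1.ne' h2).symm
    -- A cone vector with homogenizing coordinate 0 is the zero vector. This kills $Ye_v$ when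
    -- $x_v=0$ and, in `hone`, $Y(e_0-e_v)$ when $x_v=1$.
    have hzero : ∀ v, x v = 0 → z v = 0 := by
      intro v hv
      obtain ⟨-, w, -, hw⟩ := exists_eq_smul_hom (hY.2.2 v).1
      have h1 : Y.col (some v) none = 0 := by rw [Matrix.col_apply, hsymm, hYx, hv]
      rw [h1, zero_smul] at hw
      have h2 : x i * z v = 0 := by
        rw [← hzv, hsymm]
        exact congrFun hw (some i)
      exact (mul_eq_zero.1 h2).resolve_left hi.1.ne'
    have hone : ∀ v, x v = 1 → z v = 1 := by
      intro v hv
      obtain ⟨-, w, -, hw⟩ := exists_eq_smul_hom (hY.2.2 v).2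
      have h1 : (Y.col none - Y.col (some v)) none = 0 := by
        rw [Pi.sub_apply, Matrix.col_apply, Matrix.col_apply, hsymm none (some v), hYx, hv, h0,
          sub_self]
      rw [h1, zero_smul] at hw
      have h2 : Y (some i) none - Y (some i) (some v) = 0 := congrFun hw (some i)
      rw [hYx, hsymm, hzv] at h2
      have h3 : x i * z v = x i * 1 := by linarith
      exact mul_left_cancel₀ hi.1.ne' h3
    have h1 := hhull z (hcol i hi.1 hi.2 z hzP hzi hzero hone)
    have h2 : ∑ v, a' v * Y (some i) (some v) = x i * ∑ v, a' v * z v := by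
      rw [Finset.mul_sum]
      refine Finset.sum_congr rfl fun v _ => ?_
      rw [hsymm, hzv]
      ring
    rw [h2, hYx]
    have := mul_le_mul_of_nonneg_left h1 hi.1.le
    linarith
  -- For $w=(\beta,-a')$ one has $w^{\mathsf T}Yw = \beta(\beta-\sum_v a'_vx_v)-\sum_v a'_v(Yw)_v$.
  -- The first term is negative by the violation and the sum is nonnegative by `hD`, contradicting
  -- positive semidefiniteness.
  obtain ⟨w, hw0, hw⟩ : ∃ w : Option V → ℝ, w none = β ∧ ∀ v, w (some v) = -a' v :=
    ⟨fun o => o.elim β fun v => -a' v, rfl, fun _ => rfl⟩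
  have hq := hY.1.dotProduct_mulVec_nonneg w
  have hrow : ∀ b, (Y.mulVec w) b = β * Y b none - ∑ v, a' v * Y b (some v) := by
    intro b
    simp only [Matrix.mulVec, dotProduct, Fintype.sum_option, hw0, hw]
    rw [sub_eq_add_neg, ← Finset.sum_neg_distrib]
    congr 1
    · ring
    · exact Finset.sum_congr rfl fun v _ => by ring
  rw [dotProduct, Fintype.sum_option] at hq
  simp only [hrow, Pi.star_apply, hw0, hw, star_trivial, h0, mul_one] at hq
  have h1 : ∑ v, a' v * Y none (some v) = ∑ v, a' v * x v :=
    Finset.sum_congr rfl fun v _ => by rw [hsymm, hYx]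
  have h2 : ∑ v, -a' v * (β * Y (some v) none - ∑ w, a' w * Y (some v) (some w)) ≤ 0 := by
    refine Finset.sum_nonpos fun v _ => ?_
    by_cases hv : F v
    · have := mul_nonneg (ha'0 v) (hD v hv)
      linarith
    · simp [ha', hv]
  rw [h1] at hq
  have h3 := mul_pos hβ0 (sub_pos.2 hviol)
  linarith

/-- The fractional coordinates of a point. -/
noncomputable def fracSupp (x : V → ℝ) : Finset V := by
  classical exact Finset.univ.filter fun v => 0 < x v ∧ x v < 1

lemma mem_fracSupp {x : V → ℝ} {v : V} : v ∈ fracSupp x ↔ 0 < x v ∧ x v < 1 := by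
  simp [fracSupp]

lemma integral_of_notMem_fracSupp {G : SimpleGraph V} {x : V → ℝ} (hx : x ∈ frac G) {v : V}
    (hv : v ∉ fracSupp x) : x v = 0 ∨ x v = 1 := by
  rw [mem_fracSupp] at hv
  by_contra hcon
  push Not at hcon
  exact hv ⟨lt_of_le_of_ne (hx.1 v).1 hcon.1.symm, lt_of_le_of_ne (hx.1 v).2 hcon.2⟩

/-- It suffices to treat points whose fractional coordinates induce a graph of minimum degree at
least two. -/
lemma mem_integerHull_of_minDegree [Nonempty V] (G : SimpleGraph V) (m N : ℕ)
    (h : ∀ x ∈ lsPlus^[m] (frac G), (fracSupp x).card ≤ N →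
      (∀ i ∈ fracSupp x, ∃ j ∈ fracSupp x, ∃ j' ∈ fracSupp x, j ≠ j' ∧ G.Adj i j ∧ G.Adj i j') →
      x ∈ integerHull (frac G)) :
    ∀ x ∈ lsPlus^[m] (frac G), (fracSupp x).card ≤ N → x ∈ integerHull (frac G) := by
  classical
  intro x hx hcard
  induction hn : (fracSupp x).card using Nat.strong_induction_on generalizing x with
  | _ n ih =>
    by_cases hdeg : ∀ i ∈ fracSupp x,
        ∃ j ∈ fracSupp x, ∃ j' ∈ fracSupp x, j ≠ j' ∧ G.Adj i j ∧ G.Adj i j'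
    · exact h x hx hcard hdeg
    push Not at hdeg
    obtain ⟨i, hi, hdeg⟩ := hdeg
    have hxf := iterate_lsPlus_frac_subset G m hx
    have hi' := mem_fracSupp.1 hi
    have hnb : ∀ j, G.Adj i j → 0 < x j → j ∈ fracSupp x := by
      intro j hij hj
      have := hxf.2 i j hij
      exact mem_fracSupp.2 ⟨hj, by linarith⟩
    refine mem_integerHull_of_pendant G hxf hi'.1 (fun j j' hij hij' hj hj' => ?_) ?_
    · by_contra hne
      exact hdeg j (hnb j hij hj) j' (hnb j' hij' hj') hne hij hij'
    · have hsub : substPt (fun v => if v = i then Lit.zero else Lit.pos v) x =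
          Function.update x i 0 := by
        ext v
        by_cases hv : v = i <;> simp [substPt, hv, Lit.eval]
      have hmem : Function.update x i 0 ∈ lsPlus^[m] (frac G) := by
        rw [← hsub]
        refine subst_mem_iterate_lsPlus (convex_frac G) (fun z hz => ?_) m x hx
        have hle : ∀ v, 0 ≤ substPt (fun v => if v = i then Lit.zero else Lit.pos v) z v ∧
            substPt (fun v => if v = i then Lit.zero else Lit.pos v) z v ≤ z v := by
          intro v
          have := (hz.1 v).1
          by_cases hv : v = i
          · subst hv
            simpa [substPt, Lit.eval] using this
          · simpa [substPt, hv, Lit.eval] using this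
        refine ⟨fun v => ⟨(hle v).1, (hle v).2.trans (hz.1 v).2⟩, fun v w hvw => ?_⟩
        exact (add_le_add (hle v).2 (hle w).2).trans (hz.2 v w hvw)
      have hlt : (fracSupp (Function.update x i 0)).card < (fracSupp x).card := by
        refine Finset.card_lt_card (Finset.ssubset_iff_subset_ne.2 ⟨fun v hv => ?_, fun he => ?_⟩)
        · rw [mem_fracSupp] at hv ⊢
          by_cases hvi : v = i
          · subst hvi
            simp at hv
          · simpa [hvi] using hv
        · rw [← he, mem_fracSupp] at hi
          simp at hi
      exact ih _ (hn ▸ hlt) _ hmem (hlt.le.trans hcard) rfl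

/-- A point of the `m`-th iterate with at most `3m + 2` fractional coordinates lies in the stable
set polytope. -/
theorem mem_integerHull_of_card_fracSupp [Nonempty V] (G : SimpleGraph V) (m : ℕ) :
    ∀ x ∈ lsPlus^[m] (frac G), (fracSupp x).card ≤ 3 * m + 2 → x ∈ integerHull (frac G) := by
  classical
  have htriple : ∀ (x : V → ℝ) (i j j' : V), i ∈ fracSupp x → j ∈ fracSupp x → j' ∈ fracSupp x →
      j ≠ j' → G.Adj i j → G.Adj i j' →
      ({i, j, j'} : Finset V) ⊆ fracSupp x ∧ ({i, j, j'} : Finset V).card = 3 := by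
    intro x i j j' hi hj hj' hne hij hij'
    refine ⟨?_, Finset.card_eq_three.2 ⟨i, j, j', hij.ne, hij'.ne, hne, rfl⟩⟩
    intro v hv
    simp only [Finset.mem_insert, Finset.mem_singleton] at hv
    rcases hv with rfl | rfl | rfl <;> assumption
  induction m with
  | zero =>
    -- Minimum degree two needs three vertices, so with at most two fractional coordinates there are
    -- none.
    refine mem_integerHull_of_minDegree G _ _ fun x hx hcard hdeg => ?_
    rcases (fracSupp x).eq_empty_or_nonempty with he | ⟨i, hi⟩
    · exact mem_integerHull_frac G hx fun i => integral_of_notMem_fracSupp hx (by simp [he])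
    · obtain ⟨j, hj, j', hj', hne, hij, hij'⟩ := hdeg i hi
      obtain ⟨hsub, h3⟩ := htriple x i j j' hi hj hj' hne hij hij'
      have := Finset.card_le_card hsub
      omega
  | succ m ihm =>
    refine mem_integerHull_of_minDegree G _ _ fun x hx hcard hdeg => ?_
    have hxf := iterate_lsPlus_frac_subset G _ hx
    rw [Function.iterate_succ_apply'] at hx
    refine mem_integerHull_of_mem_lsPlus G hxf hx fun i hi0 hi1 z hz hzi hz0 hz1 => ?_
    refine ihm z hz ?_
    have hzf := iterate_lsPlus_frac_subset G _ hz
    obtain ⟨j, hj, j', hj', hne, hij, hij'⟩ := hdeg i (mem_fracSupp.2 ⟨hi0, hi1⟩)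
    obtain ⟨hsub, h3⟩ := htriple x i j j' (mem_fracSupp.2 ⟨hi0, hi1⟩) hj hj' hne hij hij'
    have hnbr : ∀ w, G.Adj i w → z w = 0 := by
      intro w hw
      have := hzf.2 i w hw
      have := (hzf.1 w).1
      linarith
    -- The vertex $i$ and two of its fractional neighbours become integral: three coordinates per
    -- round.
    have hss : fracSupp z ⊆ fracSupp x \ {i, j, j'} := by
      intro v hv
      have hv' := mem_fracSupp.1 hv
      simp only [Finset.mem_sdiff, Finset.mem_insert, Finset.mem_singleton, not_or]
      refine ⟨?_, ?_, ?_, ?_⟩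
      · by_contra hcon
        rcases integral_of_notMem_fracSupp hxf hcon with h | h
        · exact hv'.1.ne' (hz0 v h)
        · exact hv'.2.ne (hz1 v h)
      · rintro rfl
        exact hv'.2.ne hzi
      · rintro rfl
        exact hv'.1.ne' (hnbr _ hij)
      · rintro rfl
        exact hv'.1.ne' (hnbr _ hij')
    have h4 := Finset.card_le_card hss
    rw [Finset.card_sdiff_of_subset hsub, h3] at h4
    omega

/-- The `LS₊`-rank of a graph is at most a third of its number of vertices. -/
theorem iterate_lsPlus_eq_integerHull [Nonempty V] (G : SimpleGraph V) (m : ℕ)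
    (h : Fintype.card V ≤ 3 * m + 2) : lsPlus^[m] (frac G) = integerHull (frac G) :=
  Set.Subset.antisymm
    (fun x hx => mem_integerHull_of_card_fracSupp G m x hx ((Finset.card_le_univ _).trans h))
    (integerHull_subset_iterate_lsPlus (convex_frac G) m)

end Upper

end LSPlus

namespace LSPlus

open Filter Topology

/-! ### Perturbing a sum of rank-one matrices inside the lifted set. -/

section Perturbation

variable {V : Type*}

/-- The sum of a cone `C` and of the linear span of `F`: the directions in which a point in the
relative interior of the cone generated by `F ⊆ C` can be moved inside `C`. -/
def tangent (C F : Set (Option V → ℝ)) : Set (Option V → ℝ) :=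
  {z | ∃ s ∈ Submodule.span ℝ F, ∃ g ∈ C, z = s + g}

lemma add_mem_tangent {P : Set (V → ℝ)} (hP : Convex ℝ P) {F : Set (Option V → ℝ)}
    {y z : Option V → ℝ} (hy : y ∈ tangent (homCone P) F) (hz : z ∈ tangent (homCone P) F) :
    y + z ∈ tangent (homCone P) F := by
  obtain ⟨s, hs, g, hg, rfl⟩ := hy
  obtain ⟨s', hs', g', hg', rfl⟩ := hz
  exact ⟨s + s', add_mem hs hs', g + g', add_mem_homCone hP hg hg', add_add_add_comm _ _ _ _⟩

lemma smul_mem_tangent {P : Set (V → ℝ)} {F : Set (Option V → ℝ)} {z : Option V → ℝ}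
    (hz : z ∈ tangent (homCone P) F) {c : ℝ} (hc : 0 ≤ c) : c • z ∈ tangent (homCone P) F := by
  obtain ⟨s, hs, g, hg, rfl⟩ := hz
  exact ⟨c • s, Submodule.smul_mem _ _ hs, c • g, smul_mem_homCone hg hc, smul_add _ _ _⟩

lemma mem_tangent_of_span {P : Set (V → ℝ)} (hP : P.Nonempty) {F : Set (Option V → ℝ)}
    {z : Option V → ℝ} (hz : z ∈ Submodule.span ℝ F) : z ∈ tangent (homCone P) F :=
  ⟨z, hz, 0, zero_mem_homCone hP, (add_zero z).symm⟩

lemma tangent_mono {C F F' : Set (Option V → ℝ)} (h : F ⊆ F') : tangent C F ⊆ tangent C F' := by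
  rintro z ⟨s, hs, g, hg, rfl⟩
  exact ⟨s, Submodule.span_mono h hs, g, hg, rfl⟩

lemma map_mem_tangent {W : Type*} {C F : Set (Option V → ℝ)} {C' F' : Set (Option W → ℝ)}
    (L : (Option V → ℝ) →ₗ[ℝ] (Option W → ℝ)) (hC : ∀ y ∈ C, L y ∈ C') (hF : ∀ y ∈ F, L y ∈ F')
    {z : Option V → ℝ} (hz : z ∈ tangent C F) : L z ∈ tangent C' F' := by
  obtain ⟨s, hs, g, hg, rfl⟩ := hz
  refine ⟨L s, ?_, L g, hC g hg, map_add _ _ _⟩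
  have : Submodule.span ℝ F ≤ (Submodule.span ℝ F').comap L :=
    Submodule.span_le.2 fun y hy => Submodule.subset_span (hF y hy)
  exact this hs

/-- Adding $\varepsilon\sum c_y y$ changes the coefficient of each $y$ from 1 to $1+\varepsilon
c_y$, which is still nonnegative for small $\varepsilon$. -/
lemma eventually_sum_add_smul_mem {P : Set (V → ℝ)} (hP : Convex ℝ P)
    {F : Finset (Option V → ℝ)} (hF : ∀ y ∈ F, y ∈ homCone P) {z : Option V → ℝ}
    (hz : z ∈ tangent (homCone P) (F : Set (Option V → ℝ))) :
    ∀ᶠ ε : ℝ in 𝓝[>] 0, ∑ y ∈ F, y + ε • z ∈ homCone P := by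
  obtain ⟨s, hs, g, hg, rfl⟩ := hz
  obtain ⟨c, -, rfl⟩ := Submodule.mem_span_finset.1 hs
  have h1 : ∀ y ∈ F, ∀ᶠ ε : ℝ in 𝓝[>] 0, 0 ≤ 1 + ε * c y := by
    intro y _
    have ht : Tendsto (fun ε : ℝ => 1 + ε * c y) (𝓝[>] 0) (𝓝 (1 + 0 * c y)) := by
      refine Tendsto.mono_left ?_ nhdsWithin_le_nhds
      exact (Continuous.tendsto (by fun_prop) 0)
    rw [zero_mul, add_zero] at ht
    exact (ht.eventually (lt_mem_nhds zero_lt_one)).mono fun _ h => h.le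
  filter_upwards [(Finset.eventually_all F).2 h1, self_mem_nhdsWithin] with ε hε hpos
  have h2 : ∑ y ∈ F, y + ε • (∑ y ∈ F, c y • y + g) = ∑ y ∈ F, (1 + ε * c y) • y + ε • g := by
    simp only [add_smul, one_smul, Finset.sum_add_distrib, smul_add, Finset.smul_sum, mul_smul,
      add_assoc]
  rw [h2]
  exact add_mem_homCone hP
    (sum_mem_homCone hP (nonempty_of_mem_homCone hg) _ _ fun y hy =>
      smul_mem_homCone (hF y hy) (hε y hy))
    (smul_mem_homCone hg (le_of_lt hpos))

/-- A sum of squares of linear forms stays positive semidefinite under a small perturbation which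
is positive on the common kernel of the forms. -/
lemma eventually_posSemidef {ι : Type*} [Fintype ι] (M : Finset (ι → ℝ)) {Z : Matrix ι ι ℝ}
    (hZ : Z.IsHermitian)
    (hker : ∀ w : ι → ℝ, (∀ y ∈ M, y ⬝ᵥ w = 0) → w ≠ 0 → 0 < w ⬝ᵥ Z.mulVec w) :
    ∀ᶠ ε : ℝ in 𝓝[>] 0, (∑ y ∈ M, Matrix.vecMulVec y y + ε • Z).PosSemidef := by
  set q : (ι → ℝ) → ℝ := fun w => ∑ y ∈ M, (y ⬝ᵥ w) ^ 2 with hq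
  set r : (ι → ℝ) → ℝ := fun w => w ⬝ᵥ Z.mulVec w with hr
  have hqc : Continuous q := by
    simp only [hq, dotProduct]
    fun_prop
  have hrc : Continuous r := by
    simp only [hr, dotProduct, Matrix.mulVec]
    fun_prop
  have hq0 : ∀ w, 0 ≤ q w := fun w => Finset.sum_nonneg fun y _ => sq_nonneg _
  have hS : IsCompact (Metric.sphere (0 : ι → ℝ) 1) := isCompact_sphere _ _
  have hbound : ∀ᶠ ε : ℝ in 𝓝[>] 0, ∀ w ∈ Metric.sphere (0 : ι → ℝ) 1, 0 ≤ q w + ε * r w := by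
    -- The perturbation can only hurt on the compact part of the sphere where `r` is nonpositive.
    -- There `q` has no zero by `hker`, so it has a positive minimum, while `r` is bounded below.
    set N : Set (ι → ℝ) := Metric.sphere 0 1 ∩ {w | r w ≤ 0} with hN
    have hNc : IsCompact N := hS.inter_right (isClosed_le hrc continuous_const)
    rcases N.eq_empty_or_nonempty with he | hne
    · filter_upwards [self_mem_nhdsWithin] with ε hε w hw
      have : 0 ≤ r w := by
        by_contra hcon
        have : w ∈ N := ⟨hw, (not_le.1 hcon).le⟩
        simp [he] at this
      exact add_nonneg (hq0 w) (mul_nonneg (le_of_lt hε) this)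
    · obtain ⟨w₀, hw₀, hmin⟩ := hNc.exists_isMinOn hne hqc.continuousOn
      obtain ⟨w₁, hw₁, hmin₁⟩ := hNc.exists_isMinOn hne hrc.continuousOn
      have hμ : 0 < q w₀ := by
        refine lt_of_le_of_ne (hq0 _) fun h0 => ?_
        have hz : ∀ y ∈ M, y ⬝ᵥ w₀ = 0 := by
          have := (Finset.sum_eq_zero_iff_of_nonneg fun y _ => sq_nonneg (y ⬝ᵥ w₀)).1 h0.symm
          exact fun y hy => pow_eq_zero_iff two_ne_zero |>.1 (this y hy)
        have hw0 : w₀ ≠ 0 := by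
          rintro rfl
          simpa using hw₀.1
        exact absurd (hker w₀ hz hw0) (not_lt.2 hw₀.2)
      have ht : Tendsto (fun ε : ℝ => q w₀ + ε * r w₁) (𝓝[>] 0) (𝓝 (q w₀ + 0 * r w₁)) :=
        Tendsto.mono_left (Continuous.tendsto (by fun_prop) 0) nhdsWithin_le_nhds
      rw [zero_mul, add_zero] at ht
      filter_upwards [ht.eventually (lt_mem_nhds hμ), self_mem_nhdsWithin] with ε hε hpos w hw
      rcases le_or_gt (r w) 0 with h | h
      · have h1 : q w₀ ≤ q w := hmin ⟨hw, h⟩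
        have h2 : r w₁ ≤ r w := hmin₁ ⟨hw, h⟩
        have h3 := mul_le_mul_of_nonneg_left h2 (le_of_lt hpos)
        linarith
      · exact add_nonneg (hq0 w) (mul_nonneg (le_of_lt hpos) h.le)
  filter_upwards [hbound] with ε hε
  refine Matrix.PosSemidef.of_dotProduct_mulVec_nonneg ?_ fun w => ?_
  · refine Matrix.IsHermitian.add ?_ ?_
    · exact (Matrix.posSemidef_sum M fun y _ => by
        simpa using Matrix.posSemidef_vecMulVec_self_star y).1
    · rw [Matrix.IsHermitian, Matrix.conjTranspose_smul, hZ.eq, star_trivial]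
  · have hform : ∀ w : ι → ℝ,
        w ⬝ᵥ (∑ y ∈ M, Matrix.vecMulVec y y + ε • Z).mulVec w = q w + ε * r w := by
      intro w
      rw [Matrix.add_mulVec, dotProduct_add, Matrix.smul_mulVec, dotProduct_smul, smul_eq_mul,
        Matrix.sum_mulVec, dotProduct_sum]
      congr 1
      refine Finset.sum_congr rfl fun y _ => ?_
      rw [Matrix.vecMulVec_mulVec, dotProduct_smul, dotProduct_comm w y]
      simp [sq]
    rw [star_trivial, hform]
    rcases eq_or_ne w 0 with rfl | hw
    · simp [hq, hr]
    · have hn : 0 < ‖w‖ := norm_pos_iff.2 hw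
      have h1 := hε (‖w‖⁻¹ • w) (by simp [norm_smul, hn.ne'])
      rw [← hform, Matrix.mulVec_smul, smul_dotProduct, dotProduct_smul, hform,
        smul_eq_mul, smul_eq_mul, ← mul_assoc] at h1
      exact nonneg_of_mul_nonneg_right h1 (by positivity)

/-- A sum of rank-one matrices of `0/1` points can be perturbed inside the lifted set. -/
theorem exists_perturbation_mem_liftedSet [Fintype V] {P : Set (V → ℝ)} (hP : Convex ℝ P)
    (M : Finset (Option V → ℝ)) (hM : ∀ y ∈ M, y ∈ homCone P) (hM1 : ∀ y ∈ M, y none = 1)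
    (hM01 : ∀ y ∈ M, ∀ v, y (some v) = 0 ∨ y (some v) = 1)
    {Z : Matrix (Option V) (Option V) ℝ} (hZ : ∀ a b, Z a b = Z b a)
    (hZd : ∀ a, Z a none = Z a a)
    (hcol : ∀ v, Z.col (some v) ∈ tangent (homCone P) {y | y ∈ M ∧ y (some v) = 1})
    (hcol' : ∀ v, Z.col none - Z.col (some v) ∈
      tangent (homCone P) {y | y ∈ M ∧ y (some v) = 0})
    (hker : ∀ w : Option V → ℝ, (∀ y ∈ M, y ⬝ᵥ w = 0) → w ≠ 0 → 0 < w ⬝ᵥ Z.mulVec w) :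
    ∃ ε : ℝ, 0 < ε ∧ ∑ y ∈ M, Matrix.vecMulVec y y + ε • Z ∈ liftedSet P := by
  classical
  have hZH : Z.IsHermitian := by
    ext a b
    simpa using hZ b a
  -- As the $y$ are 0/1, the column at $v$ of $\sum yy^{\mathsf T}$ is the sum of the $y$ with
  -- $y_v=1$, and its complement is the sum of those with $y_v=0$.
  have h1 : ∀ v, ∀ᶠ ε : ℝ in 𝓝[>] 0,
      ∑ y ∈ M.filter (fun y => y (some v) = 1), y + ε • Z.col (some v) ∈ homCone P := fun v =>
    eventually_sum_add_smul_mem hP (fun y hy => hM y (Finset.mem_filter.1 hy).1)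
      (by simpa using hcol v)
  have h2 : ∀ v, ∀ᶠ ε : ℝ in 𝓝[>] 0,
      ∑ y ∈ M.filter (fun y => y (some v) = 0), y + ε • (Z.col none - Z.col (some v)) ∈
        homCone P := fun v =>
    eventually_sum_add_smul_mem hP (fun y hy => hM y (Finset.mem_filter.1 hy).1)
      (by simpa using hcol' v)
  obtain ⟨ε, hε, hε1, hε2, hpos⟩ := ((eventually_posSemidef M hZH hker).and
    ((eventually_all.2 h1).and ((eventually_all.2 h2).and self_mem_nhdsWithin))).exists
  refine ⟨ε, hpos, hε, ?_, fun v => ⟨?_, ?_⟩⟩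
  · ext a
    simp only [Matrix.col_apply, Matrix.diag_apply, Matrix.add_apply, Matrix.smul_apply, hZd a,
      Matrix.sum_apply, Matrix.vecMulVec_apply]
    congr 1
    refine Finset.sum_congr rfl fun y hy => ?_
    cases a with
    | none => rfl
    | some v => rcases hM01 y hy v with h | h <;> simp [h, hM1 y hy]
  · convert hε1 v using 1
    ext a
    simp only [Matrix.col_apply, Matrix.add_apply, Matrix.smul_apply, Matrix.sum_apply,
      Matrix.vecMulVec_apply, Pi.add_apply, Pi.smul_apply, Finset.sum_apply]
    rw [Finset.sum_filter]
    congr 1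
    refine Finset.sum_congr rfl fun y hy => ?_
    rcases hM01 y hy v with h | h <;> simp [h]
  · convert hε2 v using 1
    ext a
    simp only [Matrix.col_apply, Matrix.add_apply, Matrix.smul_apply, Matrix.sum_apply,
      Matrix.vecMulVec_apply, Pi.add_apply, Pi.smul_apply, Finset.sum_apply, Pi.sub_apply,
      smul_sub]
    rw [Finset.sum_filter, add_sub_add_comm, ← Finset.sum_sub_distrib]
    congr 1
    refine Finset.sum_congr rfl fun y hy => ?_
    rcases hM01 y hy v with h | h <;> simp [h, hM1 y hy]

end Perturbation

end LSPlus

namespace LSPlus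

/-! ### Stretched cliques and the span of their maximum stable sets. -/

/-- The edges of the stretched clique over a linear order `I`, each listed with one orientation. -/
inductive StretchEdge (I : Type*) [LT I] : Fin 3 ⊕ (I × Fin 3) → Fin 3 ⊕ (I × Fin 3) → Prop
  | e12 : StretchEdge I (.inl 0) (.inl 1)
  | e23 : StretchEdge I (.inl 1) (.inl 2)
  | e13 : StretchEdge I (.inl 0) (.inl 2)
  | hub1 (i : I) : StretchEdge I (.inr (i, 0)) (.inr (i, 1))
  | hub2 (i : I) : StretchEdge I (.inr (i, 0)) (.inr (i, 2))
  | wing12 (i : I) : StretchEdge I (.inr (i, 1)) (.inl 1)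
  | wing13 (i : I) : StretchEdge I (.inr (i, 1)) (.inl 2)
  | wing21 (i : I) : StretchEdge I (.inr (i, 2)) (.inl 0)
  | cross (i j : I) : i < j → StretchEdge I (.inr (i, 2)) (.inr (j, 1))

/-- The stretched clique: a triangle together with one stretched vertex for each element of `I`. -/
def stretched (I : Type*) [LinearOrder I] : SimpleGraph (Fin 3 ⊕ (I × Fin 3)) :=
  SimpleGraph.fromRel (StretchEdge I)

/-- The index set is generalized to a linear order because the induction deletes arbitrary stretched
vertices, after which the indices need not form an interval. -/
lemma graphA_eq_stretched (k : ℕ) : graphA k = stretched ↥(Finset.Icc 4 k) := by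
  have h : AEdge k = StretchEdge ↥(Finset.Icc 4 k) := by
    ext a b
    constructor
    · rintro (_ | _ | _ | i | i | i | i | i | ⟨i, j, h⟩) <;> constructor
      exact h
    · rintro (_ | _ | _ | i | i | i | i | i | ⟨i, j, h⟩) <;> constructor
      exact h
  rw [graphA, stretched, h]

section Stretched

variable {I : Type*} [LinearOrder I]

lemma mem_frac_stretched_iff {x : Fin 3 ⊕ (I × Fin 3) → ℝ} :
    x ∈ frac (stretched I) ↔
      (∀ v, 0 ≤ x v ∧ x v ≤ 1) ∧ ∀ a b, StretchEdge I a b → x a + x b ≤ 1 := by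
  refine and_congr_right fun _ => ⟨fun h a b hab => h a b ?_, fun h a b hab => ?_⟩
  · rw [stretched, SimpleGraph.fromRel_adj]
    refine ⟨?_, Or.inl hab⟩
    rintro rfl
    cases hab
  · rw [stretched, SimpleGraph.fromRel_adj] at hab
    rcases hab.2 with h1 | h1
    · exact h a b h1
    · rw [add_comm]
      exact h b a h1

/-- The vector equal to the indicator of `i_0` outside of the triangle and of one stretched
vertex. -/
def config (A : Fin 3 → ℝ) (i : I) (b : Fin 3 → ℝ) : Fin 3 ⊕ (I × Fin 3) → ℝ :=
  Sum.elim A fun p => if p.1 = i then b p.2 else if p.2 = 0 then 1 else 0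

/-- The stable set consisting of a vertex of the triangle and of all vertices `i_0`. -/
def baseConfig (I : Type*) (p : Fin 3) : Fin 3 ⊕ (I × Fin 3) → ℝ :=
  Sum.elim (Pi.single p 1) fun q => if q.2 = 0 then 1 else 0

lemma config_eq_baseConfig (p : Fin 3) (i : I) :
    config (Pi.single p 1) i (Pi.single 0 1) = baseConfig I p := by
  ext v
  rcases v with v | ⟨j, c⟩
  · rfl
  · simp only [config, baseConfig, Sum.elim_inr, Pi.single_apply]
    split_ifs <;> rfl

/-- The coordinate vector of a vertex in the homogenized space. -/
def unit {V : Type*} [DecidableEq V] (v : V) : Option V → ℝ := Pi.single (some v) 1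

lemma unit_none {V : Type*} [DecidableEq V] (v : V) : unit v none = 0 := by simp [unit]

lemma unit_some {V : Type*} [DecidableEq V] (v w : V) :
    unit v (some w) = if w = v then 1 else 0 := by
  simp [unit, Pi.single_apply]

lemma hom_config_sub (A A' : Fin 3 → ℝ) (i : I) (b b' : Fin 3 → ℝ) :
    hom (config A i b) - hom (config A' i b') =
      ∑ p, (A p - A' p) • unit (Sum.inl p) + ∑ c, (b c - b' c) • unit (Sum.inr (i, c)) := by
  ext o
  rcases o with _ | p | ⟨j, c⟩
  · simp [unit_none]
  · simp [unit_some, config]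
  · by_cases hj : j = i <;> simp [unit_some, config, hj]

lemma hom_baseConfig_sub (p q : Fin 3) :
    hom (baseConfig I p) - hom (baseConfig I q) = unit (Sum.inl p) - unit (Sum.inl q) := by
  ext o
  rcases o with _ | r | ⟨j, c⟩
  · simp [unit_none]
  · simp [unit_some, baseConfig, Pi.single_apply]
  · simp [unit_some, baseConfig]

/-- The stable set `{1, i_1} ∪ {j_0 : j ≠ i}`. -/
def configA (i : I) : Fin 3 ⊕ (I × Fin 3) → ℝ := config ![1, 0, 0] i ![0, 1, 0]

/-- The stable set `{p, i_2} ∪ {j_0 : j ≠ i}`, for a vertex `p ∈ {2, 3}` of the triangle. -/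
def configB (p : Fin 3) (i : I) : Fin 3 ⊕ (I × Fin 3) → ℝ := config (Pi.single p 1) i ![0, 0, 1]

/-- The stable set `{i_1, i_2} ∪ {j_0 : j ≠ i}`. -/
def configC (i : I) : Fin 3 ⊕ (I × Fin 3) → ℝ := config 0 i ![0, 1, 1]

lemma hom_baseConfig_sub_configA (i : I) :
    hom (baseConfig I 0) - hom (configA i) = unit (Sum.inr (i, 0)) - unit (Sum.inr (i, 1)) := by
  rw [← config_eq_baseConfig 0 i, configA, hom_config_sub]
  simp [Fin.sum_univ_three, sub_eq_add_neg]

lemma hom_baseConfig_sub_configB (p : Fin 3) (i : I) :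
    hom (baseConfig I p) - hom (configB p i) =
      unit (Sum.inr (i, 0)) - unit (Sum.inr (i, 2)) := by
  rw [← config_eq_baseConfig p i, configB, hom_config_sub]
  simp [Fin.sum_univ_three, sub_eq_add_neg]

lemma hom_configC_sub_configA (i : I) :
    hom (configC i) - hom (configA i) = unit (Sum.inr (i, 2)) - unit (Sum.inl 0) := by
  rw [configC, configA, hom_config_sub]
  simp [Fin.sum_univ_three, sub_eq_add_neg, add_comm]

variable [Fintype I]

/-- The (indicator vectors of) stable sets of size `|I| + 1`. -/
def maxStable (I : Type*) [LinearOrder I] [Fintype I] : Set (Fin 3 ⊕ (I × Fin 3) → ℝ) :=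
  {x | x ∈ frac (stretched I) ∧ (∀ v, x v = 0 ∨ x v = 1) ∧ ∑ v, x v = Fintype.card I + 1}

/-- The vertices $j_0$ with $j\ne i$ have no neighbour that is used, so only conditions on the
triangle and on $i$ remain. There are $|I|-1$ of them, hence the value 2 in `hsum`. -/
lemma config_mem_maxStable {A : Fin 3 → ℝ} {i : I} {b : Fin 3 → ℝ}
    (hA : ∀ p, A p = 0 ∨ A p = 1) (hb : ∀ c, b c = 0 ∨ b c = 1)
    (h01 : A 0 + A 1 ≤ 1) (h12 : A 1 + A 2 ≤ 1) (h02 : A 0 + A 2 ≤ 1)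
    (hb1 : b 0 + b 1 ≤ 1) (hb2 : b 0 + b 2 ≤ 1) (hbA1 : b 1 + A 1 ≤ 1) (hbA2 : b 1 + A 2 ≤ 1)
    (hbA0 : b 2 + A 0 ≤ 1) (hsum : A 0 + A 1 + A 2 + (b 0 + b 1 + b 2) = 2) :
    config A i b ∈ maxStable I := by
  have h : ∀ v, config A i b v = 0 ∨ config A i b v = 1 := by
    rintro (p | ⟨j, c⟩)
    · exact hA p
    · simp only [config, Sum.elim_inr]
      split_ifs
      · exact hb c
      · exact Or.inr rfl
      · exact Or.inl rfl
  have hA1 : ∀ p, A p ≤ 1 := fun p => by rcases hA p with h | h <;> simp [h]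
  have hb1' : ∀ p, b p ≤ 1 := fun p => by rcases hb p with h | h <;> simp [h]
  refine ⟨mem_frac_stretched_iff.2 ⟨fun v => by rcases h v with h | h <;> simp [h], ?_⟩, h, ?_⟩
  · rintro _ _ (_ | _ | _ | j | j | j | j | j | ⟨j, l, hjl⟩)
    · exact h01
    · exact h12
    · exact h02
    · by_cases hj : j = i <;> simp [config, hj, hb1]
    · by_cases hj : j = i <;> simp [config, hj, hb2]
    · by_cases hj : j = i <;> simp [config, hj, hbA1, hA1]
    · by_cases hj : j = i <;> simp [config, hj, hbA2, hA1]
    · by_cases hj : j = i <;> simp [config, hj, hbA0, hA1]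
    · by_cases hj : j = i
      · have : l ≠ i := by
          rintro rfl
          exact hjl.ne hj
        simp [config, hj, this, hb1']
      · by_cases hl : l = i <;> simp [config, hj, hl, hb1']
  · rw [Fintype.sum_sum_type, Fintype.sum_prod_type]
    have h1 : ∀ j, ∑ c, config A i b (Sum.inr (j, c)) =
        1 + if j = i then b 0 + b 1 + b 2 - 1 else 0 := by
      intro j
      by_cases hj : j = i <;> simp [config, hj, Fin.sum_univ_three]
    simp only [h1, Finset.sum_add_distrib, Finset.sum_ite_eq', Finset.mem_univ, if_true]
    simp only [config, Sum.elim_inl, Fin.sum_univ_three, Finset.sum_const, Finset.card_univ,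
      nsmul_eq_mul, mul_one]
    linarith

lemma baseConfig_mem_maxStable (p : Fin 3) : baseConfig I p ∈ maxStable I := by
  have h : ∀ v, baseConfig I p v = 0 ∨ baseConfig I p v = 1 := by
    rintro (q | ⟨j, c⟩)
    · simp only [baseConfig, Sum.elim_inl, Pi.single_apply]
      split_ifs <;> simp
    · simp only [baseConfig, Sum.elim_inr]
      split_ifs <;> simp
  have hA : ∀ q, baseConfig I p (.inl q) ≤ 1 := fun q => by
    rcases h (.inl q) with h | h <;> simp [h]
  refine ⟨mem_frac_stretched_iff.2 ⟨fun v => by rcases h v with h | h <;> simp [h], ?_⟩, h, ?_⟩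
  · rintro _ _ (_ | _ | _ | j | j | j | j | j | ⟨j, l, hjl⟩)
    · fin_cases p <;> simp [baseConfig]
    · fin_cases p <;> simp [baseConfig]
    · fin_cases p <;> simp [baseConfig]
    · simp [baseConfig]
    · simp [baseConfig]
    · simpa [baseConfig] using hA 1
    · simpa [baseConfig] using hA 2
    · simpa [baseConfig] using hA 0
    · simp [baseConfig]
  · rw [Fintype.sum_sum_type, Fintype.sum_prod_type]
    simp [baseConfig, Pi.single_apply, add_comm]

/-- The homogenized stable sets of size `|I| + 1`. -/
def face (I : Type*) [LinearOrder I] [Fintype I] : Set (Option (Fin 3 ⊕ (I × Fin 3)) → ℝ) :=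
  hom '' maxStable I

lemma finite_face : (face I).Finite :=
  (finite_integral_points.subset fun _ hx => hx.2.1).image _

lemma configA_mem (i : I) : configA i ∈ maxStable I := by
  apply config_mem_maxStable
  · intro p; fin_cases p <;> simp
  · intro p; fin_cases p <;> simp
  all_goals simp <;> norm_num

lemma configB_mem {p : Fin 3} (hp : p ≠ 0) (i : I) : configB p i ∈ maxStable I := by
  apply config_mem_maxStable
  · intro q; simp only [Pi.single_apply]; split_ifs <;> simp
  · intro q; fin_cases q <;> simp
  all_goals fin_cases p <;> simp at hp ⊢ <;> norm_num

lemma configC_mem (i : I) : configC i ∈ maxStable I := by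
  apply config_mem_maxStable
  · intro p; simp
  · intro p; fin_cases p <;> simp
  all_goals simp <;> norm_num

lemma hom_mem_span_face {x : Fin 3 ⊕ (I × Fin 3) → ℝ} (hx : x ∈ maxStable I) :
    hom x ∈ Submodule.span ℝ (face I) := Submodule.subset_span ⟨x, hx, rfl⟩

/-- Differences of two maximum stable sets that exchange a single vertex. The exchanges used, among
triangle vertices and $i_2\leftrightarrow 1$, $i_0\leftrightarrow i_2$, $i_0\leftrightarrow i_1$,
connect all vertices, so `face I` spans a hyperplane. -/
lemma unit_sub_mem_span_face (v : Fin 3 ⊕ (I × Fin 3)) :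
    unit v - unit (Sum.inl 0) ∈ Submodule.span ℝ (face I) := by
  rcases v with p | ⟨i, c⟩
  · rw [← hom_baseConfig_sub]
    exact sub_mem (hom_mem_span_face (baseConfig_mem_maxStable p))
      (hom_mem_span_face (baseConfig_mem_maxStable 0))
  · have h2 : unit (Sum.inr (i, 2)) - unit (Sum.inl 0) ∈ Submodule.span ℝ (face I) := by
      rw [← hom_configC_sub_configA]
      exact sub_mem (hom_mem_span_face (configC_mem i)) (hom_mem_span_face (configA_mem i))
    have h0 : unit (Sum.inr (i, 0)) - unit (Sum.inl 0) ∈ Submodule.span ℝ (face I) := by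
      rw [← sub_add_sub_cancel _ (unit (Sum.inr (i, 2))), ← hom_baseConfig_sub_configB 1]
      exact add_mem (sub_mem (hom_mem_span_face (baseConfig_mem_maxStable 1))
        (hom_mem_span_face (configB_mem (by decide) i))) h2
    have h1 : unit (Sum.inr (i, 1)) - unit (Sum.inl 0) ∈ Submodule.span ℝ (face I) := by
      have h := sub_mem h0 (sub_mem (hom_mem_span_face (baseConfig_mem_maxStable 0))
        (hom_mem_span_face (configA_mem i)))
      rw [hom_baseConfig_sub_configA] at h
      convert h using 1
      abel
    fin_cases c
    · exact h0
    · exact h1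
    · exact h2

/-- Modulo the span of the maximum stable sets, every vector is a multiple of a coordinate
vector. -/
lemma sub_smul_unit_mem_span_face (z : Option (Fin 3 ⊕ (I × Fin 3)) → ℝ) :
    z - (∑ v, z (some v) - (Fintype.card I + 1) * z none) • unit (Sum.inl 0) ∈
      Submodule.span ℝ (face I) := by
  have hgen : ∀ y : Option (Fin 3 ⊕ (I × Fin 3)) → ℝ, y none = 0 →
      y - (∑ v, y (some v)) • unit (Sum.inl 0) ∈ Submodule.span ℝ (face I) := by
    intro y hy
    have h : y - (∑ v, y (some v)) • unit (Sum.inl 0) =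
        ∑ v, y (some v) • (unit v - unit (Sum.inl 0)) := by
      simp only [smul_sub, Finset.sum_sub_distrib, ← Finset.sum_smul]
      congr 1
      ext o
      cases o with
      | none => simp [unit_none, hy]
      | some v => simp [unit_some, Finset.sum_apply]
    rw [h]
    exact Submodule.sum_mem _ fun v _ => Submodule.smul_mem _ _ (unit_sub_mem_span_face v)
  have hb := baseConfig_mem_maxStable (I := I) 0
  have h := add_mem (hgen (z - z none • hom (baseConfig I 0)) (by simp))
    (Submodule.smul_mem _ (z none) (hom_mem_span_face hb))
  convert h using 1
  have hs : ∑ v, (z - z none • hom (baseConfig I 0)) (some v) =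
      ∑ v, z (some v) - (Fintype.card I + 1) * z none := by
    simp only [Pi.sub_apply, Pi.smul_apply, hom_some, smul_eq_mul, Finset.sum_sub_distrib,
      ← Finset.mul_sum, hb.2.2]
    ring
  rw [hs]
  abel

/-- Modulo the span of the face, a vector is determined by its excess in the cardinality inequality.
The violating point has positive excess `δ`, so `δ⁻¹ • hom x` agrees with any coordinate vector
modulo this span. -/
lemma unit_mem_tangent {P : Set (Fin 3 ⊕ (I × Fin 3) → ℝ)}
    {x : Fin 3 ⊕ (I × Fin 3) → ℝ} (hx : x ∈ P) (hsum : Fintype.card I + 1 < ∑ v, x v)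
    (v : Fin 3 ⊕ (I × Fin 3)) : unit v ∈ tangent (homCone P) (face I) := by
  set δ : ℝ := ∑ v, x v - (Fintype.card I + 1) with hδ
  have hδ0 : 0 < δ := sub_pos.2 hsum
  have h := sub_smul_unit_mem_span_face (hom x)
  simp only [hom_some, hom_none, mul_one, ← hδ] at h
  refine ⟨(unit v - unit (Sum.inl 0)) - δ⁻¹ • (hom x - δ • unit (Sum.inl 0)),
    sub_mem (unit_sub_mem_span_face v) (Submodule.smul_mem _ _ h), δ⁻¹ • hom x,
    smul_mem_homCone (hom_mem_homCone.2 hx) (inv_nonneg.2 hδ0.le), ?_⟩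
  rw [smul_sub, inv_smul_smul₀ hδ0.ne']
  abel

/-- The value of a linear functional vanishing on the maximum stable sets. -/
lemma dotProduct_of_orthogonal_face {w : Option (Fin 3 ⊕ (I × Fin 3)) → ℝ}
    (hw : ∀ y ∈ face I, y ⬝ᵥ w = 0) (z : Option (Fin 3 ⊕ (I × Fin 3)) → ℝ) :
    z ⬝ᵥ w = (∑ v, z (some v) - (Fintype.card I + 1) * z none) * w (some (Sum.inl 0)) := by
  have hspan : ∀ y ∈ Submodule.span ℝ (face I), y ⬝ᵥ w = 0 := by
    intro y hy
    induction hy using Submodule.span_induction with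
    | mem y hy => exact hw y hy
    | zero => exact zero_dotProduct w
    | add y z _ _ hy hz => rw [add_dotProduct, hy, hz, add_zero]
    | smul c y _ hy => rw [smul_dotProduct, hy, smul_zero]
  have h := hspan _ (sub_smul_unit_mem_span_face z)
  rw [sub_dotProduct, smul_dotProduct, unit, single_dotProduct, one_mul, smul_eq_mul] at h
  exact sub_eq_zero.1 h

end Stretched

end LSPlus

namespace LSPlus

/-! ### Substitutions that add one stretched vertex. -/

section Insert

variable {I : Type*} [LinearOrder I]

/-- The substitution from the graph over `I \ {i}` to the graph over `I` given by the literals `A`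
on the triangle and `B` on the stretched vertex `i`. -/
def insertLit (i : I) (A B : Fin 3 → Lit (Fin 3 ⊕ ({j : I // j ≠ i} × Fin 3))) :
    Fin 3 ⊕ (I × Fin 3) → Lit (Fin 3 ⊕ ({j : I // j ≠ i} × Fin 3)) :=
  Sum.elim A fun q => if h : q.1 = i then B q.2 else .pos (.inr (⟨q.1, h⟩, q.2))

variable {i : I} {A B : Fin 3 → Lit (Fin 3 ⊕ ({j : I // j ≠ i} × Fin 3))}

lemma substPt_insertLit_inl (x : Fin 3 ⊕ ({j : I // j ≠ i} × Fin 3) → ℝ) (p : Fin 3) :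
    substPt (insertLit i A B) x (.inl p) = (A p).eval (hom x) := rfl

lemma substPt_insertLit_self (x : Fin 3 ⊕ ({j : I // j ≠ i} × Fin 3) → ℝ) (c : Fin 3) :
    substPt (insertLit i A B) x (.inr (i, c)) = (B c).eval (hom x) := by
  simp [substPt, insertLit]

lemma substPt_insertLit_ne (x : Fin 3 ⊕ ({j : I // j ≠ i} × Fin 3) → ℝ) {j : I} (hj : j ≠ i)
    (c : Fin 3) : substPt (insertLit i A B) x (.inr (j, c)) = x (.inr (⟨j, hj⟩, c)) := by
  simp [substPt, insertLit, hj, Lit.eval]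

lemma Lit.eval_mem_unitInterval {V : Type*} {x : V → ℝ} (hx : ∀ v, 0 ≤ x v ∧ x v ≤ 1)
    (l : Lit V) : 0 ≤ l.eval (hom x) ∧ l.eval (hom x) ≤ 1 := by
  cases l with
  | zero => simp [Lit.eval]
  | one => simp [Lit.eval]
  | pos v => exact hx v
  | neg v =>
    have := hx v
    simp only [Lit.eval, hom_none, hom_some]
    constructor <;> linarith

lemma Lit.eval_integral {V : Type*} {x : V → ℝ} (hx : ∀ v, x v = 0 ∨ x v = 1)
    (l : Lit V) : l.eval (hom x) = 0 ∨ l.eval (hom x) = 1 := by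
  cases l with
  | zero => simp [Lit.eval]
  | one => simp [Lit.eval]
  | pos v => exact hx v
  | neg v => rcases hx v with h | h <;> simp [Lit.eval, h]

lemma substPt_insertLit_mem_frac {x : Fin 3 ⊕ ({j : I // j ≠ i} × Fin 3) → ℝ}
    (hx : x ∈ frac (stretched {j : I // j ≠ i})) {a b : Fin 3 → ℝ}
    (ha : ∀ p, (A p).eval (hom x) = a p) (hb : ∀ c, (B c).eval (hom x) = b c)
    (h01 : a 0 + a 1 ≤ 1) (h12 : a 1 + a 2 ≤ 1) (h02 : a 0 + a 2 ≤ 1)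
    (hb1 : b 0 + b 1 ≤ 1) (hb2 : b 0 + b 2 ≤ 1) (hba1 : b 1 + a 1 ≤ 1) (hba2 : b 1 + a 2 ≤ 1)
    (hba0 : b 2 + a 0 ≤ 1)
    (hx1 : ∀ j, x (.inr (j, 1)) + a 1 ≤ 1 ∧ x (.inr (j, 1)) + a 2 ≤ 1)
    (hx2 : ∀ j, x (.inr (j, 2)) + a 0 ≤ 1)
    (hgt : ∀ j : {j : I // j ≠ i}, i < j → b 2 + x (.inr (j, 1)) ≤ 1)
    (hlt : ∀ j : {j : I // j ≠ i}, j < i → x (.inr (j, 2)) + b 1 ≤ 1) :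
    substPt (insertLit i A B) x ∈ frac (stretched I) := by
  rw [mem_frac_stretched_iff] at hx ⊢
  have hl : ∀ p, substPt (insertLit i A B) x (.inl p) = a p := ha
  have hi : ∀ c, substPt (insertLit i A B) x (.inr (i, c)) = b c := fun c => by
    rw [substPt_insertLit_self, hb]
  have hne : ∀ {j : I} (hj : j ≠ i) (c : Fin 3),
      substPt (insertLit i A B) x (.inr (j, c)) = x (.inr (⟨j, hj⟩, c)) :=
    fun hj c => substPt_insertLit_ne x hj c
  refine ⟨fun v => Lit.eval_mem_unitInterval hx.1 _, ?_⟩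
  rintro _ _ (_ | _ | _ | j | j | j | j | j | ⟨j, l, hjl⟩)
  · rwa [hl, hl]
  · rwa [hl, hl]
  · rwa [hl, hl]
  · by_cases hj : j = i
    · subst hj
      rwa [hi, hi]
    · rw [hne hj, hne hj]
      exact hx.2 _ _ (.hub1 _)
  · by_cases hj : j = i
    · subst hj
      rwa [hi, hi]
    · rw [hne hj, hne hj]
      exact hx.2 _ _ (.hub2 _)
  · by_cases hj : j = i
    · subst hj
      rwa [hi, hl]
    · rw [hne hj, hl]
      exact (hx1 _).1
  · by_cases hj : j = i
    · subst hj
      rwa [hi, hl]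
    · rw [hne hj, hl]
      exact (hx1 _).2
  · by_cases hj : j = i
    · subst hj
      rwa [hi, hl]
    · rw [hne hj, hl]
      exact hx2 _
  · by_cases hj : j = i
    · subst hj
      rw [hi, hne hjl.ne']
      exact hgt ⟨l, hjl.ne'⟩ hjl
    · by_cases hl' : l = i
      · subst hl'
        rw [hi, hne hj]
        exact hlt ⟨j, hj⟩ hjl
      · rw [hne hj, hne hl']
        exact hx.2 _ _ (.cross _ _ hjl)

variable [Fintype I]

lemma sum_substPt_insertLit (x : Fin 3 ⊕ ({j : I // j ≠ i} × Fin 3) → ℝ) :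
    ∑ v, substPt (insertLit i A B) x v = ∑ v, x v + (∑ p, (A p).eval (hom x) +
      ∑ c, (B c).eval (hom x) - ∑ p, x (.inl p)) := by
  rw [Fintype.sum_sum_type, Fintype.sum_sum_type, Fintype.sum_prod_type, Fintype.sum_prod_type,
    Fintype.sum_eq_add_sum_subtype_ne _ i]
  have h : ∀ j : {j : I // j ≠ i}, ∑ c, substPt (insertLit i A B) x (.inr (j, c)) =
      ∑ c, x (.inr (j, c)) := fun j =>
    Finset.sum_congr rfl fun c _ => substPt_insertLit_ne x j.2 c
  simp only [h, substPt_insertLit_inl, substPt_insertLit_self]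
  ring

/-- A substitution as above which raises the sum of the coordinates by one transports tangent
directions. -/
lemma subst_insertLit_mem_tangent {m : ℕ}
    (hfrac : ∀ x ∈ frac (stretched {j : I // j ≠ i}),
      substPt (insertLit i A B) x ∈ frac (stretched I))
    (hsum : ∀ x, ∑ p, (A p).eval (hom x) + ∑ c, (B c).eval (hom x) = ∑ p, x (.inl p) + 1)
    {c : (Option (Fin 3 ⊕ (I × Fin 3)) → ℝ) → Prop} (hc : ∀ x, c (hom (substPt (insertLit i A B) x)))
    {z : Option (Fin 3 ⊕ ({j : I // j ≠ i} × Fin 3)) → ℝ}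
    (hz : z ∈ tangent (homCone (lsPlus^[m] (frac (stretched {j : I // j ≠ i}))))
      (face {j : I // j ≠ i})) :
    subst (insertLit i A B) z ∈
      tangent (homCone (lsPlus^[m] (frac (stretched I)))) {y | y ∈ face I ∧ c y} := by
  refine map_mem_tangent _ (fun y hy => ?_) (fun y hy => ?_) hz
  · exact subst_mem_homCone (subst_mem_iterate_lsPlus (convex_frac _) hfrac m) hy
  · obtain ⟨x, hx, rfl⟩ := hy
    rw [subst_hom]
    refine ⟨⟨_, ⟨hfrac x hx.1, fun v => Lit.eval_integral hx.2.1 _, ?_⟩, rfl⟩, hc x⟩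
    have hcard : Fintype.card I = Fintype.card {j : I // j ≠ i} + 1 := by
      rw [Fintype.card_subtype_compl, Fintype.card_subtype_eq]
      have := Fintype.card_pos_iff.2 ⟨i⟩
      omega
    rw [sum_substPt_insertLit, hsum, hx.2.2, hcard]
    push_cast
    ring

end Insert

/-! ### Tangent directions inherited from smaller stretched cliques. -/

section Directions

variable {I : Type*} [LinearOrder I] [Fintype I]

/-- Directions available in the face `x_{i_0} = 1`. -/
lemma unit_mem_tangent_hub {m : ℕ} (i : I)
    (h : ∀ v, unit v ∈ tangent (homCone (lsPlus^[m] (frac (stretched {j : I // j ≠ i}))))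
      (face {j : I // j ≠ i})) {v : Fin 3 ⊕ (I × Fin 3)} (hv : ∀ c, v ≠ .inr (i, c)) :
    unit v ∈ tangent (homCone (lsPlus^[m] (frac (stretched I))))
      {y | y ∈ face I ∧ y (some (.inr (i, 0))) = 1} := by
  -- Choosing $i_0$ excludes $i_1$ and $i_2$ and leaves the smaller graph untouched.
  set A : Fin 3 → Lit (Fin 3 ⊕ ({j : I // j ≠ i} × Fin 3)) := fun p => .pos (.inl p) with hA
  set B : Fin 3 → Lit (Fin 3 ⊕ ({j : I // j ≠ i} × Fin 3)) := ![.one, .zero, .zero] with hB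
  have hfrac : ∀ x ∈ frac (stretched {j : I // j ≠ i}),
      substPt (insertLit i A B) x ∈ frac (stretched I) := by
    intro x hx
    have hx' := mem_frac_stretched_iff.1 hx
    refine substPt_insertLit_mem_frac hx (a := fun p => x (.inl p)) (b := ![1, 0, 0])
      (fun p => rfl) (fun c => by fin_cases c <;> rfl) (hx'.2 _ _ .e12) (hx'.2 _ _ .e23)
      (hx'.2 _ _ .e13) (by simp) (by simp) ?_ ?_ ?_
      (fun j => ⟨hx'.2 _ _ (.wing12 j), hx'.2 _ _ (.wing13 j)⟩)
      (fun j => hx'.2 _ _ (.wing21 j)) (fun j _ => ?_) (fun j _ => ?_)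
    · simpa using (hx'.1 _).2
    · simpa using (hx'.1 _).2
    · simpa using (hx'.1 _).2
    · simpa using (hx'.1 _).2
    · simpa using (hx'.1 _).2
  have hsum : ∀ x, ∑ p, (A p).eval (hom x) + ∑ c, (B c).eval (hom x) = ∑ p, x (.inl p) + 1 := by
    intro x
    simp [hA, hB, Fin.sum_univ_three, Lit.eval]
  obtain ⟨w, hw⟩ : ∃ w, subst (insertLit i A B) (unit w) = unit v := by
    rcases v with p | ⟨j, c⟩
    · refine ⟨.inl p, ?_⟩
      ext o
      rcases o with _ | q | ⟨l, d⟩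
      · simp [unit_none]
      · simp [insertLit, hA, Lit.eval, unit_some]
      · by_cases hl : l = i
        · subst hl
          fin_cases d <;> simp [insertLit, hB, Lit.eval, unit_some, unit_none]
        · simp [insertLit, hl, Lit.eval, unit_some]
    · have hj : j ≠ i := fun h => hv c (by rw [h])
      refine ⟨.inr (⟨j, hj⟩, c), ?_⟩
      ext o
      rcases o with _ | q | ⟨l, d⟩
      · simp [unit_none]
      · simp [insertLit, hA, Lit.eval, unit_some]
      · by_cases hl : l = i
        · subst hl
          fin_cases d <;> simp [insertLit, hB, Lit.eval, unit_some, unit_none, hj.symm]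
        · simp [insertLit, hl, Lit.eval, unit_some]
  rw [← hw]
  refine subst_insertLit_mem_tangent (c := fun y => y (some (.inr (i, 0))) = 1) hfrac hsum
    (fun x => ?_) (h w)
  rw [hom_some, substPt_insertLit_self]
  rfl

/-- The direction of `t_1` in the face `x_{t_2} = 1`, for the last stretched vertex `t`. -/
lemma unit_mem_tangent_last {m : ℕ} {t : I} (ht : ∀ j, j ≤ t)
    (h : ∀ v, unit v ∈ tangent (homCone (lsPlus^[m] (frac (stretched {j : I // j ≠ t}))))
      (face {j : I // j ≠ t})) :
    unit (.inr (t, 1)) ∈ tangent (homCone (lsPlus^[m] (frac (stretched I))))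
      {y | y ∈ face I ∧ y (some (.inr (t, 2))) = 1} := by
  -- With $t_2$ chosen, the vertices $1$ and $t_0$ are excluded. As $t$ is last, $t_2$ has no cross
  -- edges and the remaining neighbours of $t_1$ are $2$, $3$ and all $j_2$, exactly those of vertex
  -- $1$ in the smaller graph; so $t_1$ takes over its role.
  set A : Fin 3 → Lit (Fin 3 ⊕ ({j : I // j ≠ t} × Fin 3)) :=
    ![.zero, .pos (.inl 1), .pos (.inl 2)] with hA
  set B : Fin 3 → Lit (Fin 3 ⊕ ({j : I // j ≠ t} × Fin 3)) :=
    ![.zero, .pos (.inl 0), .one] with hB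
  have hfrac : ∀ x ∈ frac (stretched {j : I // j ≠ t}),
      substPt (insertLit t A B) x ∈ frac (stretched I) := by
    intro x hx
    have hx' := mem_frac_stretched_iff.1 hx
    refine substPt_insertLit_mem_frac hx (a := ![0, x (.inl 1), x (.inl 2)])
      (b := ![0, x (.inl 0), 1])
      (fun p => by fin_cases p <;> rfl) (fun c => by fin_cases c <;> rfl) ?_ (hx'.2 _ _ .e23)
      ?_ ?_ (by simp) (hx'.2 _ _ .e12) (hx'.2 _ _ .e13) (by simp)
      (fun j => ⟨hx'.2 _ _ (.wing12 j), hx'.2 _ _ (.wing13 j)⟩)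
      (fun j => ?_) (fun j hj => absurd hj (not_lt.2 (ht j)))
      (fun j _ => hx'.2 _ _ (.wing21 j))
    · simpa using (hx'.1 _).2
    · simpa using (hx'.1 _).2
    · simpa using (hx'.1 _).2
    · simpa using (hx'.1 _).2
  have hsum : ∀ x, ∑ p, (A p).eval (hom x) + ∑ c, (B c).eval (hom x) = ∑ p, x (.inl p) + 1 := by
    intro x
    simp [hA, hB, Fin.sum_univ_three, Lit.eval]
    ring
  have hw : subst (insertLit t A B) (unit (.inl 0)) = unit (.inr (t, 1)) := by
    ext o
    rcases o with _ | q | ⟨l, d⟩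
    · simp [unit_none]
    · fin_cases q <;> simp [insertLit, hA, Lit.eval, unit_some]
    · by_cases hl : l = t
      · subst hl
        fin_cases d <;> simp [insertLit, hB, Lit.eval, unit_some, unit_none]
      · simp [insertLit, hl, Lit.eval, unit_some]
  rw [← hw]
  refine subst_insertLit_mem_tangent (c := fun y => y (some (.inr (t, 2))) = 1) hfrac hsum
    (fun x => ?_) (h _)
  rw [hom_some, substPt_insertLit_self]
  rfl

/-- The direction of the first vertex of the triangle in the face `x_q = 0`, for another vertex `q`
of the triangle: the first stretched vertex `b` takes over the role of `q`. -/
lemma unit_mem_tangent_first {m : ℕ} {b : I} (hb : ∀ j, b ≤ j) {q : Fin 3} (hq : q ≠ 0)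
    (h : ∀ v, unit v ∈ tangent (homCone (lsPlus^[m] (frac (stretched {j : I // j ≠ b}))))
      (face {j : I // j ≠ b})) :
    unit (.inl 0) ∈ tangent (homCone (lsPlus^[m] (frac (stretched I))))
      {y | y ∈ face I ∧ y (some (.inl q)) = 0} := by
  -- The pair $b_1,b_2$ replaces $q$. As $b$ is first, $b_2$ sees $1$ and every other $j_1$, while
  -- $b_1$ sees $2$ and $3$ and no $j_2$; these are constraints that $q$ already had. The vertex
  -- $b_0$ takes the complementary value, which makes the sum grow by exactly one.
  set A : Fin 3 → Lit (Fin 3 ⊕ ({j : I // j ≠ b} × Fin 3)) :=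
    fun p => if p = q then .zero else .pos (.inl p) with hA
  set B : Fin 3 → Lit (Fin 3 ⊕ ({j : I // j ≠ b} × Fin 3)) :=
    ![.neg (.inl q), .pos (.inl q), .pos (.inl q)] with hB
  have hfrac : ∀ x ∈ frac (stretched {j : I // j ≠ b}),
      substPt (insertLit b A B) x ∈ frac (stretched I) := by
    intro x hx
    have hx' := mem_frac_stretched_iff.1 hx
    have hl : ∀ j : {j : I // j ≠ b}, ¬ (j : I) < b := fun j => not_lt.2 (hb j)
    have h01 := hx'.2 _ _ .e12
    have h12 := hx'.2 _ _ .e23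
    have h02 := hx'.2 _ _ .e13
    have w1 := fun j => hx'.2 _ _ (.wing12 j)
    have w2 := fun j => hx'.2 _ _ (.wing13 j)
    have w0 := fun j => hx'.2 _ _ (.wing21 j)
    have p1 := fun v => (hx'.1 v).2
    obtain rfl | rfl : q = 1 ∨ q = 2 := by omega
    · refine substPt_insertLit_mem_frac hx (a := ![x (.inl 0), 0, x (.inl 2)])
        (b := ![1 - x (.inl 1), x (.inl 1), x (.inl 1)])
        (fun p => by fin_cases p <;> rfl) (fun c => by fin_cases c <;> rfl)
        ?_ ?_ h02 ?_ ?_ ?_ h12 ?_ (fun j => ⟨?_, w2 j⟩) w0 (fun j _ => ?_)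
        (fun j hj => absurd hj (hl j))
      · simpa using p1 _
      · simpa using p1 _
      · simp
      · simp
      · simpa using p1 _
      · simpa [add_comm] using h01
      · simpa using p1 _
      · simpa [add_comm] using w1 j
    · refine substPt_insertLit_mem_frac hx (a := ![x (.inl 0), x (.inl 1), 0])
        (b := ![1 - x (.inl 2), x (.inl 2), x (.inl 2)])
        (fun p => by fin_cases p <;> rfl) (fun c => by fin_cases c <;> rfl)
        h01 ?_ ?_ ?_ ?_ ?_ ?_ ?_ (fun j => ⟨w1 j, ?_⟩) w0 (fun j _ => ?_)
        (fun j hj => absurd hj (hl j))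
      · simpa using p1 _
      · simpa using p1 _
      · simp
      · simp
      · simpa [add_comm] using h12
      · simpa using p1 _
      · simpa [add_comm] using h02
      · simpa using p1 _
      · simpa [add_comm] using w2 j
  have hsum : ∀ x, ∑ p, (A p).eval (hom x) + ∑ c, (B c).eval (hom x) = ∑ p, x (.inl p) + 1 := by
    intro x
    obtain rfl | rfl : q = 1 ∨ q = 2 := by omega
    · simp [hA, hB, Fin.sum_univ_three, Lit.eval]
      ring
    · simp [hA, hB, Fin.sum_univ_three, Lit.eval]
      ring
  have hw : subst (insertLit b A B) (unit (.inl 0)) = unit (.inl 0) := by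
    ext o
    rcases o with _ | p | ⟨l, d⟩
    · simp [unit_none]
    · by_cases hp : p = q
      · subst hp
        simp [insertLit, hA, Lit.eval, unit_some, hq]
      · simp [insertLit, hA, Lit.eval, unit_some, hp]
    · by_cases hl : l = b
      · subst hl
        fin_cases d <;> simp [insertLit, hB, Lit.eval, unit_some, unit_none, hq]
      · simp [insertLit, hl, Lit.eval, unit_some]
  rw [← hw]
  refine subst_insertLit_mem_tangent (c := fun y => y (some (.inl q)) = 0) hfrac hsum
    (fun x => ?_) (h _)
  rw [hom_some, substPt_insertLit_inl]
  simp [hA, Lit.eval]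

/-- Vertices used by some stable set of a face give descending directions. -/
lemma neg_unit_mem_tangent {m : ℕ} {F : Set (Option (Fin 3 ⊕ (I × Fin 3)) → ℝ)}
    {x : Fin 3 ⊕ (I × Fin 3) → ℝ} (hx : x ∈ maxStable I) (hxF : hom x ∈ F)
    {v : Fin 3 ⊕ (I × Fin 3)} (hv : x v = 1) :
    -unit v ∈ tangent (homCone (lsPlus^[m] (frac (stretched I)))) F := by
  have hle : ∀ w, Function.update x v 0 w ≤ x w := by
    intro w
    by_cases hw : w = v
    · subst hw
      simp [hv]
    · simp [hw]
  have h01 : ∀ w, Function.update x v 0 w = 0 ∨ Function.update x v 0 w = 1 := by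
    intro w
    by_cases hw : w = v
    · subst hw
      simp
    · simpa [hw] using hx.2.1 w
  have hfrac : Function.update x v 0 ∈ frac (stretched I) :=
    ⟨fun w => by rcases h01 w with h | h <;> simp [h],
      fun a b hab => (add_le_add (hle a) (hle b)).trans (hx.1.2 a b hab)⟩
  -- Removing $v$ from the stable set leaves a stable set, and $-e_v$ is the difference of the two.
  refine ⟨-hom x, neg_mem (Submodule.subset_span hxF), hom (Function.update x v 0),
    hom_mem_homCone.2 (mem_iterate_lsPlus_of_integral hfrac h01 m), ?_⟩
  · ext o
    rcases o with _ | w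
    · simp [unit_none]
    · by_cases hw : w = v
      · subst hw
        simp [unit_some, hv]
      · simp [unit_some, hw]

end Directions

end LSPlus

namespace LSPlus

/-! ### Lower bound: the perturbation and the induction on the number of stretched vertices. -/

section Violation

variable {I : Type*} [LinearOrder I] [Fintype I]

lemma face_adj_subset {a b : Fin 3 ⊕ (I × Fin 3)} (hab : StretchEdge I a b ∨ StretchEdge I b a) :
    {y | y ∈ face I ∧ y (some a) = 1} ⊆ {y | y ∈ face I ∧ y (some b) = 0} := by
  rintro _ ⟨⟨x, hx, rfl⟩, ha⟩
  refine ⟨⟨x, hx, rfl⟩, ?_⟩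
  have hx' := mem_frac_stretched_iff.1 hx.1
  have h1 : x a + x b ≤ 1 := by
    rcases hab with h | h
    · exact hx'.2 _ _ h
    · rw [add_comm]
      exact hx'.2 _ _ h
  have h2 := (hx'.1 b).1
  simp only [hom_some] at *
  linarith

/-- The perturbation direction, at the stretched vertex `t`. -/
noncomputable def perturbation (t : I) :
    Matrix (Option (Fin 3 ⊕ (I × Fin 3))) (Option (Fin 3 ⊕ (I × Fin 3))) ℝ :=
  -- The vector $h=2\,$`hom (configC t)`$\,-\,$`hom (configA t)` has value 1 at the homogenizing
  -- coordinate and at $t_1$. Hence column 0 is $e_{t_1}$, and subtracting $e_{t_1}e_{t_1}^{\mathsf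
  -- T}$ corrects the diagonal entry at $t_1$ from 2 to 1. The last two terms do not affect column 0
  -- or the diagonal; they supply positivity on the kernel.
  Matrix.vecMulVec (unit (.inr (t, 1))) ((2 : ℝ) • hom (configC t) - hom (configA t)) +
  Matrix.vecMulVec ((2 : ℝ) • hom (configC t) - hom (configA t)) (unit (.inr (t, 1))) -
  Matrix.vecMulVec (unit (.inr (t, 1))) (unit (.inr (t, 1))) +
  Matrix.vecMulVec (unit (.inl 0)) (unit (.inr (t, 0))) +
  Matrix.vecMulVec (unit (.inr (t, 0))) (unit (.inl 0))

omit [Fintype I] in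
lemma perturbation_col (t : I) (a : Option (Fin 3 ⊕ (I × Fin 3))) :
    (perturbation t).col a =
      (2 * hom (configC t) a - hom (configA t) a) • unit (.inr (t, 1)) +
      unit (.inr (t, 1)) a • ((2 : ℝ) • hom (configC t) - hom (configA t)) -
      unit (.inr (t, 1)) a • unit (.inr (t, 1)) + unit (.inr (t, 0)) a • unit (.inl 0) +
      unit (.inl 0) a • unit (.inr (t, 0)) := by
  ext b
  simp only [perturbation, Matrix.col_apply, Matrix.add_apply, Matrix.sub_apply,
    Matrix.vecMulVec_apply, Pi.add_apply, Pi.sub_apply, Pi.smul_apply, smul_eq_mul]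
  ring

omit [Fintype I] in
lemma perturbation_symm (t : I) (a b : Option (Fin 3 ⊕ (I × Fin 3))) :
    perturbation t a b = perturbation t b a := by
  simp only [perturbation, Matrix.add_apply, Matrix.sub_apply, Matrix.vecMulVec_apply]
  ring

omit [Fintype I] in
lemma perturbation_col_none (t : I) : (perturbation t).col none = unit (.inr (t, 1)) := by
  rw [perturbation_col]
  simp [unit_none]
  norm_num

omit [Fintype I] in
lemma perturbation_diag (t : I) (a : Option (Fin 3 ⊕ (I × Fin 3))) :
    perturbation t a none = perturbation t a a := by
  have h := congrFun (perturbation_col_none t) a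
  rw [Matrix.col_apply] at h
  rw [h]
  have h' := congrFun (perturbation_col t a) a
  rw [Matrix.col_apply] at h'
  rw [h']
  rcases a with _ | p | ⟨j, c⟩
  · simp [unit_none]
  · by_cases hp : p = 0 <;> simp [unit_some, hp]
  · by_cases hj : j = t
    · subst hj
      fin_cases c <;> simp [unit_some, configA, configC, config]; norm_num
    · simp [unit_some, hj]

/-- A functional $w$ orthogonal to the face has one common value $c$ on all vertices and kills $h$,
so the five terms of the form give $0+0-c^2+c^2+c^2$. -/
lemma perturbation_pos (t : I) {w : Option (Fin 3 ⊕ (I × Fin 3)) → ℝ}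
    (hw : ∀ y ∈ face I, y ⬝ᵥ w = 0) (hne : w ≠ 0) : 0 < w ⬝ᵥ (perturbation t).mulVec w := by
  have hd := dotProduct_of_orthogonal_face hw
  set c := w (some (.inl 0)) with hc
  have hc0 : c ≠ 0 := by
    intro h0
    refine hne (funext fun a => ?_)
    have := hd (Pi.single a 1)
    rwa [h0, mul_zero, single_one_dotProduct] at this
  have hunit : ∀ v, unit v ⬝ᵥ w = c := by
    intro v
    rw [hd]
    simp [unit_some, unit_none]
  have hh : ((2 : ℝ) • hom (configC t) - hom (configA t)) ⬝ᵥ w = 0 := by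
    rw [sub_dotProduct, smul_dotProduct, hw _ ⟨_, configC_mem t, rfl⟩,
      hw _ ⟨_, configA_mem t, rfl⟩]
    simp
  have hr : ∀ p q : Option (Fin 3 ⊕ (I × Fin 3)) → ℝ,
      (Matrix.vecMulVec p q).mulVec w ⬝ᵥ w = (q ⬝ᵥ w) * (p ⬝ᵥ w) := by
    intro p q
    rw [Matrix.vecMulVec_mulVec, op_smul_eq_smul, smul_dotProduct, smul_eq_mul]
  have : w ⬝ᵥ (perturbation t).mulVec w = c ^ 2 := by
    rw [dotProduct_comm, perturbation, Matrix.add_mulVec, Matrix.add_mulVec, Matrix.sub_mulVec,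
      Matrix.add_mulVec, add_dotProduct, add_dotProduct, sub_dotProduct, add_dotProduct]
    simp only [hr, hunit, hh]
    ring
  rw [this]
  positivity

/-- If all graphs with one stretched vertex less violate the cardinality inequality after `n`
rounds, then the graph itself violates it after `n + 1` rounds. -/
lemma exists_violation_succ [Nonempty I] {n : ℕ}
    (h : ∀ i : I, ∃ x ∈ lsPlus^[n] (frac (stretched {j : I // j ≠ i})),
      (Fintype.card {j : I // j ≠ i} : ℝ) + 1 < ∑ v, x v) :
    ∃ x ∈ lsPlus^[n + 1] (frac (stretched I)), (Fintype.card I : ℝ) + 1 < ∑ v, x v := by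
  classical
  obtain ⟨t, ht⟩ := Finite.exists_max (id : I → I)
  obtain ⟨b, hb⟩ := Finite.exists_min (id : I → I)
  simp only [id] at ht hb
  set P := lsPlus^[n] (frac (stretched I)) with hP
  have hconv : Convex ℝ P := convex_iterate_lsPlus (convex_frac _) n
  have hPne : P.Nonempty :=
    ⟨0, mem_iterate_lsPlus_of_integral (zero_mem_frac _) (fun _ => Or.inl rfl) n⟩
  have hsub : ∀ i : I, ∀ v, unit v ∈
      tangent (homCone (lsPlus^[n] (frac (stretched {j : I // j ≠ i})))) (face {j : I // j ≠ i}) := by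
    intro i v
    obtain ⟨x, hx, hsum⟩ := h i
    exact unit_mem_tangent hx hsum v
  have hhub : ∀ i v, (∀ c, v ≠ .inr (i, c)) → unit v ∈ tangent (homCone P)
      {y | y ∈ face I ∧ y (some (.inr (i, 0))) = 1} :=
    fun i v hv => unit_mem_tangent_hub i (hsub i) hv
  have hlast : unit (.inr (t, 1)) ∈ tangent (homCone P)
      {y | y ∈ face I ∧ y (some (.inr (t, 2))) = 1} := unit_mem_tangent_last ht (hsub t)
  have hfirst : ∀ {q : Fin 3}, q ≠ 0 → unit (.inl 0) ∈ tangent (homCone P)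
      {y | y ∈ face I ∧ y (some (.inl q)) = 0} := fun hq => unit_mem_tangent_first hb hq (hsub b)
  have hspan : ∀ {F : Set (Option (Fin 3 ⊕ (I × Fin 3)) → ℝ)} {z}, z ∈ Submodule.span ℝ F →
      z ∈ tangent (homCone P) F := fun hz => mem_tangent_of_span hPne hz
  have hzero : ∀ F : Set (Option (Fin 3 ⊕ (I × Fin 3)) → ℝ), 0 ∈ tangent (homCone P) F :=
    fun F => hspan (zero_mem _)
  have hface : ∀ {x : Fin 3 ⊕ (I × Fin 3) → ℝ} {a r}, x ∈ maxStable I → x a = r →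
      hom x ∈ Submodule.span ℝ {y | y ∈ face I ∧ y (some a) = r} :=
    fun {x _ _} hx ha => Submodule.subset_span ⟨⟨x, hx, rfl⟩, ha⟩
  have hneg : ∀ {x : Fin 3 ⊕ (I × Fin 3) → ℝ} {v a r}, x ∈ maxStable I → x v = 1 → x a = r →
      -unit v ∈ tangent (homCone P) {y | y ∈ face I ∧ y (some a) = r} :=
    fun {x _ _ _} hx hv ha => neg_unit_mem_tangent hx (by exact ⟨⟨x, hx, rfl⟩, ha⟩) hv
  have htj : ∀ {j : I}, j ≠ t → ∀ c, (Sum.inr (t, 1) : Fin 3 ⊕ (I × Fin 3)) ≠ .inr (j, c) := by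
    intro j hj c hc
    simp only [Sum.inr.injEq, Prod.mk.injEq] at hc
    exact hj hc.1.symm
  -- The columns are: $e_{t_0}-e_{t_1}$ at vertex $1$, $e_1$ at $t_0$, $h$ at $t_1$, $2e_{t_1}$ at
  -- $t_2$, $e_{t_1}$ at $j_0$ for $j\ne t$, and 0 elsewhere on the vertices.
  have hcol : ∀ v, (perturbation t).col (some v) ∈
      tangent (homCone P) {y | y ∈ face I ∧ y (some v) = 1} := by
    intro v
    rw [perturbation_col]
    rcases v with p | ⟨j, c⟩
    · by_cases hp : p = 0
      · subst hp
        convert hspan (sub_mem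
          (hface (baseConfig_mem_maxStable (I := I) 0) (a := .inl 0) (r := 1)
            (by simp [baseConfig]))
          (hface (configA_mem t) rfl)) using 1
        rw [hom_baseConfig_sub_configA]
        simp [unit_some, configA, configC, config]
        abel
      · convert hzero _ using 1
        fin_cases p <;> simp [unit_some, configA, configC, config] at hp ⊢
    · by_cases hj : j = t
      · subst hj
        obtain rfl | rfl | rfl : c = 0 ∨ c = 1 ∨ c = 2 := by omega
        · convert hhub j (.inl 0) (by simp) using 1
          simp [unit_some, configA, configC, config]
        · convert hspan (sub_mem (Submodule.smul_mem _ (2 : ℝ) (hface (configC_mem j) ?_))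
            (hface (configA_mem j) ?_)) using 1
          · simp [unit_some, configA, configC, config]
            norm_num
          · simp [configC, config]
          · simp [configA, config]
        · convert smul_mem_tangent hlast (zero_le_two (α := ℝ)) using 1
          simp [unit_some, configA, configC, config]
      · by_cases hc : c = 0
        · subst hc
          convert hhub j _ (htj hj) using 1
          simp [unit_some, configA, configC, config, hj]
          norm_num
        · convert hzero _ using 1
          simp [unit_some, configA, configC, config, hj, hc]
  -- A direction found on the face $x_a=1$ is also available on $x_v=0$ whenever $a$ and $v$ are
  -- adjacent (`face_adj_subset`).
  have hcol' : ∀ v, (perturbation t).col none - (perturbation t).col (some v) ∈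
      tangent (homCone P) {y | y ∈ face I ∧ y (some v) = 0} := by
    intro v
    rw [perturbation_col_none, perturbation_col]
    rcases v with p | ⟨j, c⟩
    · by_cases hp : p = 0
      · subst hp
        have h1 := tangent_mono (face_adj_subset (Or.inl (.wing21 t))) hlast
        have h2 := hneg (baseConfig_mem_maxStable (I := I) 1) (v := .inr (t, 0)) (a := .inl 0)
          (r := 0) (by simp [baseConfig]) (by simp [baseConfig])
        convert add_mem_tangent hconv h1 (add_mem_tangent hconv h1 h2) using 1
        simp [unit_some, configA, configC, config]
        abel
      -- Here $e_{t_1}$ is needed on the face $x_p=0$. It telescopes as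
      -- $e_1+(e_{t_2}-e_1)+(e_{t_0}-e_{t_2})+(e_{t_1}-e_{t_0})$, where each difference is an
      -- exchange between maximum stable sets avoiding $p$; the second exchange uses the other
      -- triangle vertex `r`.
      · obtain ⟨r, hr0, hrp⟩ : ∃ r : Fin 3, r ≠ 0 ∧ r ≠ p := by
          refine ⟨if p = 1 then 2 else 1, ?_, ?_⟩ <;> split_ifs with h1
          · decide
          · decide
          · rw [h1]; decide
          · exact Ne.symm h1
        have h0 : configA t (.inl p) = 0 ∧ configC t (.inl p) = 0 := by
          fin_cases p <;> simp [configA, configC, config] at hp ⊢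
        have h1 := hspan (sub_mem (hface (configC_mem t) h0.2) (hface (configA_mem t) h0.1))
        have h2 := hspan (sub_mem
          (hface (baseConfig_mem_maxStable (I := I) r) (a := .inl p) (r := 0)
            (by simp [baseConfig, hrp.symm]))
          (hface (configB_mem hr0 t) (by simp [configB, config, hrp.symm])))
        have h3 := hspan (sub_mem (hface (configA_mem t) h0.1)
          (hface (baseConfig_mem_maxStable (I := I) 0) (a := .inl p) (r := 0)
            (by simp [baseConfig, hp])))
        rw [hom_configC_sub_configA] at h1
        rw [hom_baseConfig_sub_configB] at h2
        rw [← neg_sub, hom_baseConfig_sub_configA, neg_sub] at h3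
        convert add_mem_tangent hconv (hfirst hp) (add_mem_tangent hconv h1
          (add_mem_tangent hconv h2 h3)) using 1
        simp [unit_some, h0, hp]
    · by_cases hj : j = t
      · subst hj
        obtain rfl | rfl | rfl : c = 0 ∨ c = 1 ∨ c = 2 := by omega
        · have h1 := tangent_mono (face_adj_subset (Or.inr (.hub2 j))) hlast
          have h2 := hneg (configA_mem j) (v := .inl 0) (a := .inr (j, 0)) (r := 0)
            (by simp [configA, config]) (by simp [configA, config])
          convert add_mem_tangent hconv h1 h2 using 1
          simp [unit_some, configA, configC, config, sub_eq_add_neg]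
        -- The complementary column is $e_{j_1}-h = e_1+e_2-e_{j_2}-$`hom (configB 1 j)`, with both
        -- $e_1$ and $e_2$ tangent on the hub face $x_{j_0}=1$.
        · have h1 := fun q => tangent_mono (face_adj_subset (Or.inl (.hub1 j)))
            (hhub j (.inl q) (by simp))
          have h2 := hneg (configB_mem one_ne_zero j) (v := .inr (j, 2)) (a := .inr (j, 1)) (r := 0)
            (by simp [configB, config]) (by simp [configB, config])
          have h3 := hspan (neg_mem (hface (configB_mem one_ne_zero j) (a := .inr (j, 1)) (r := 0)
            (by simp [configB, config])))
          convert add_mem_tangent hconv (add_mem_tangent hconv (h1 0) (h1 1))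
            (add_mem_tangent hconv h2 h3) using 1
          ext a
          rcases a with _ | q | ⟨l, d⟩
          · simp [unit_some, unit_none, configA, configB, configC, config]
            norm_num
          · fin_cases q <;> simp [unit_some, configA, configB, configC, config]
          · by_cases hl : l = j
            · subst hl
              fin_cases d <;> simp [unit_some, configA, configB, configC, config] <;>
                norm_num
            · by_cases hd : d = 0 <;>
                simp [unit_some, configA, configB, configC, config, hl, hd]
              norm_num
        · convert hneg (configA_mem j) (v := .inr (j, 1)) (a := .inr (j, 2)) (r := 0)
            (by simp [configA, config]) (by simp [configA, config]) using 1
          simp [unit_some, configA, configC, config, two_smul]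
      · by_cases hc : c = 0
        · subst hc
          convert hzero _ using 1
          simp [unit_some, configA, configC, config, hj]
          norm_num
        · have hedge : StretchEdge I (.inr (j, 0)) (.inr (j, c)) := by
            obtain rfl | rfl : c = 1 ∨ c = 2 := by omega
            · exact .hub1 j
            · exact .hub2 j
          convert tangent_mono (face_adj_subset (Or.inl hedge)) (hhub j _ (htj hj)) using 1
          simp [unit_some, configA, configC, config, hj, hc]
  have hfin := finite_face (I := I)
  obtain ⟨ε, hε, hY⟩ := exists_perturbation_mem_liftedSet hconv hfin.toFinset
    (fun y hy => by
      obtain ⟨x, hx, rfl⟩ := hfin.mem_toFinset.1 hy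
      exact hom_mem_homCone.2 (mem_iterate_lsPlus_of_integral hx.1 hx.2.1 n))
    (fun y hy => by
      obtain ⟨x, hx, rfl⟩ := hfin.mem_toFinset.1 hy
      rfl)
    (fun y hy => by
      obtain ⟨x, hx, rfl⟩ := hfin.mem_toFinset.1 hy
      exact hx.2.1)
    (perturbation_symm t) (perturbation_diag t) (by simpa using hcol) (by simpa using hcol')
    (fun w hw => perturbation_pos t (by simpa using hw))
  set M := hfin.toFinset with hM
  set Y := ∑ y ∈ M, Matrix.vecMulVec y y + ε • perturbation t with hYdef
  have hM1 : ∀ y ∈ M, y none = 1 ∧ ∑ v, y (some v) = Fintype.card I + 1 := by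
    intro y hy
    obtain ⟨x, hx, rfl⟩ := hfin.mem_toFinset.1 hy
    exact ⟨rfl, hx.2.2⟩
  have hYcol : ∀ a, Y a none = ∑ y ∈ M, y a + ε * unit (.inr (t, 1)) a := by
    intro a
    have := congrFun (perturbation_col_none t) a
    rw [Matrix.col_apply] at this
    simp only [hYdef, Matrix.add_apply, Matrix.smul_apply, Matrix.sum_apply, this, smul_eq_mul,
      Matrix.vecMulVec_apply]
    congr 1
    exact Finset.sum_congr rfl fun y hy => by rw [(hM1 y hy).1, mul_one]
  have hMpos : 0 < (M.card : ℝ) := by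
    rw [Nat.cast_pos, Finset.card_pos]
    exact ⟨_, hfin.mem_toFinset.2 ⟨_, baseConfig_mem_maxStable 0, rfl⟩⟩
  have hY0 : Y none none = M.card := by
    rw [hYcol, unit_none, mul_zero, add_zero, Finset.sum_congr rfl fun y hy => (hM1 y hy).1]
    simp
  refine ⟨fun v => Y (some v) none / Y none none, ?_, ?_⟩
  · rw [Function.iterate_succ_apply']
    exact mem_lsPlus_of_liftedSet hY (by rw [hY0]; exact hMpos)
  · rw [← Finset.sum_div, hY0, lt_div_iff₀ hMpos]
    -- Each maximum stable set contributes exactly $|I|+1$, so the perturbation alone produces the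
    -- excess `ε`.
    have h1 : ∑ v, Y (some v) none = M.card * (Fintype.card I + 1) + ε := by
      simp only [hYcol, Finset.sum_add_distrib, unit_some]
      rw [Finset.sum_comm, Finset.sum_congr rfl fun y hy => (hM1 y hy).2]
      simp
      ring
    rw [h1]
    linarith

end Violation

/-- After `|I|` rounds the cardinality inequality is still violated. -/
theorem exists_violation (n : ℕ) : ∀ (I : Type) [LinearOrder I] [Fintype I], Fintype.card I = n →
    ∃ x ∈ lsPlus^[n] (frac (stretched I)), (Fintype.card I : ℝ) + 1 < ∑ v, x v := by
  induction n with
  | zero =>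
    intro I _ _ hI
    have : IsEmpty I := Fintype.card_eq_zero_iff.1 hI
    -- With no stretched vertices the graph is a triangle, and $3/2 > 1$.
    refine ⟨fun _ => 1 / 2, ⟨fun _ => by norm_num, fun _ _ _ => by norm_num⟩, ?_⟩
    simp
    norm_num
  | succ n ih =>
    intro I _ _ hI
    have : Nonempty I := Fintype.card_pos_iff.1 (by omega)
    refine exists_violation_succ fun i => ih _ ?_
    rw [Fintype.card_subtype_compl, Fintype.card_subtype_eq, hI]
    rfl

/-- The cardinality inequality is valid for the stable set polytope. -/
lemma sum_le_of_mem_integerHull {I : Type*} [LinearOrder I] [Fintype I]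
    {x : Fin 3 ⊕ (I × Fin 3) → ℝ} (hx : x ∈ integerHull (frac (stretched I))) :
    ∑ v, x v ≤ Fintype.card I + 1 := by
  have hconv : Convex ℝ {x : Fin 3 ⊕ (I × Fin 3) → ℝ | ∑ v, x v ≤ Fintype.card I + 1} := by
    refine convex_halfSpace_le (f := fun z : Fin 3 ⊕ (I × Fin 3) → ℝ => ∑ v, z v) ⟨?_, ?_⟩ _
    · intro y z
      simp [Finset.sum_add_distrib]
    · intro c z
      simp only [Pi.smul_apply, smul_eq_mul, Finset.mul_sum]
  refine convexHull_min ?_ hconv hx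
  rintro y ⟨hy, h01⟩
  obtain ⟨hy0, hy⟩ := mem_frac_stretched_iff.1 hy
  have hone : ∀ j, y (.inr (j, 1)) + y (.inr (j, 2)) ≤ 1 → ∑ c, y (.inr (j, c)) ≤ 1 := by
    intro j hj
    have h1 := hy _ _ (.hub1 j)
    have h2 := hy _ _ (.hub2 j)
    rw [Fin.sum_univ_three]
    rcases h01 (.inr (j, 0)) with h | h <;> linarith [(hy0 (.inr (j, 1))).1,
      (hy0 (.inr (j, 2))).1]
  have htri : y (.inl 0) + y (.inl 1) + y (.inl 2) ≤ 1 := by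
    have h1 := hy _ _ .e12
    have h2 := hy _ _ .e23
    have h3 := hy _ _ .e13
    rcases h01 (.inl 0) with h | h <;> linarith [(hy0 (.inl 1)).1, (hy0 (.inl 2)).1]
  simp only [Set.mem_ofPred_eq]
  rw [Fintype.sum_sum_type, Fintype.sum_prod_type, Fin.sum_univ_three]
  -- A stretched vertex contributes at most 1 unless both $i_1$ and $i_2$ are chosen. That choice
  -- excludes the whole triangle and, through the cross edges, cannot occur for a second index, so
  -- the total is still at most $|I|+1$.
  by_cases hfull : ∀ j, y (.inr (j, 1)) + y (.inr (j, 2)) ≤ 1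
  · have := Finset.sum_le_sum fun j (_ : j ∈ Finset.univ) => hone j (hfull j)
    simp only [Finset.sum_const, Finset.card_univ, nsmul_eq_mul, mul_one] at this
    linarith
  · push Not at hfull
    obtain ⟨i, hi⟩ := hfull
    have hi1 : y (.inr (i, 1)) = 1 :=
      (h01 _).resolve_left fun h => by linarith [(hy0 (.inr (i, 2))).2]
    have hi2 : y (.inr (i, 2)) = 1 :=
      (h01 _).resolve_left fun h => by linarith [(hy0 (.inr (i, 1))).2]
    have h0 := hy _ _ (.wing21 i)
    have h1 := hy _ _ (.wing12 i)
    have h2 := hy _ _ (.wing13 i)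
    have hb : ∀ j ∈ Finset.univ, ∑ c, y (.inr (j, c)) ≤ 1 + if j = i then (1 : ℝ) else 0 := by
      intro j _
      split_ifs with hj
      · subst hj
        have := hy _ _ (.hub1 j)
        rw [Fin.sum_univ_three]
        linarith
      · rw [add_zero]
        refine hone j ?_
        rcases lt_or_gt_of_ne hj with hlt | hgt
        · have := hy _ _ (.cross j i hlt)
          linarith [(hy0 (.inr (j, 1))).2]
        · have := hy _ _ (.cross i j hgt)
          linarith [(hy0 (.inr (j, 2))).2]
    have := Finset.sum_le_sum hb
    simp only [Finset.sum_add_distrib, Finset.sum_const, Finset.card_univ, nsmul_eq_mul, mul_one,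
      Finset.sum_ite_eq', Finset.mem_univ, if_true] at this
    linarith

end LSPlus

theorem proposition5p2 (k : ℕ) (hk : 3 ≤ k) : LSPlus.IsMinimal (LSPlus.graphA k) (k - 2) := by
  have hcard : Fintype.card ↥(Finset.Icc 4 k) = k - 3 := by
    rw [Fintype.card_coe, Nat.card_Icc]
    omega
  have hV : Fintype.card (LSPlus.AVertex k) = 3 * (k - 2) := by
    rw [Fintype.card_sum, Fintype.card_prod, hcard, Fintype.card_fin]
    omega
  refine ⟨⟨LSPlus.iterate_lsPlus_eq_integerHull _ _ (by omega), fun m hm => ?_⟩, hV⟩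
  -- A smaller $m$ satisfies $m\le k-3=|I|$; as the iterates decrease, the violating point of round
  -- $|I|$ would lie in the integer hull.
  by_contra hlt
  obtain ⟨x, hx, hsum⟩ := LSPlus.exists_violation _ ↥(Finset.Icc 4 k) rfl
  rw [LSPlus.graphA_eq_stretched] at hm
  have h1 := LSPlus.iterate_lsPlus_anti (LSPlus.convex_frac _) (by rw [hcard]; omega : m ≤ _) hx
  rw [show LSPlus.lsPlus^[m] _ = _ from hm] at h1
  exact absurd (LSPlus.sum_le_of_mem_integerHull h1) (not_le.2 hsum)
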